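/- Consider the randomized LOCAL model: in a network given by a finite simple graph $G=(V,E)$ on $n$ nodes, every node initially knows only $n$, its degree, its own input and its own independent random seed (uniform in $[0,1]$). Computation proceeds in synchronous rounds. In each round every node sends one message of arbitrary size to each of its neighbours, receives the messages of its neighbours, and performs an arbitrary local computation. The input of a node $v$ is its weight $w(v)\ge 0$, a real number, and its output is whether or not it belongs to the output set $S\subseteq V$. The set $S$ is a $(2+\varepsilon)$-approximate minimum weight vertex cover if every edge of $G$ has an endpoint in $S$ and $\sum_{v\in S}w(v)\le(2+\varepsilon)\sum_{v\in S'}w(v)$ for every vertex cover $S'$ of $G$. **Corollary.** For any $\varepsilon=\log^{-O(1)}n$, a $(2+\varepsilon)$-approximate minimum weight vertex cover can be computed in $O\!\left(\frac{\log n}{\log^2\log n}\right)$ rounds of LOCAL with high probability in $n$. Precisely: for all constants $k$ and $c$ there is a constant $C$ such that for every function $\varepsilon:\mathbb N\to(0,1]$ with $\varepsilon(n)\ge(\log n)^{-k}$ for all sufficiently large $n$ there are a randomized LOCAL algorithm and a function $T:\mathbb N\to\mathbb N$ such that, for all sufficiently large $n$, $$T(n)\le C\,\frac{\log n}{(\log\log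 n)^2},$$ and for every $n$-node graph $G$ and all node weights $w\ge 0$, the set output by the algorithm after $T(n)$ rounds is a $(2+\varepsilon(n))$-approximate minimum weight vertex cover of $G$ with probability at least $1-n^{-c}$. -/

import Mathlib

open scoped NNReal

/-- A numbering of the ports of every node of `G`: node `v` has `deg v` ports, and its ports
correspond bijectively to its neighbours (so `deg v` is the degree of `v`). -/
structure PortNumbering {V : Type} (G : SimpleGraph V) where
  deg : V → ℕ
  port : (v : V) → Fin (deg v) ≃ G.neighborSet v

namespace PortNumbering

variable {V : Type} {G : SimpleGraph V} (P : PortNumbering G)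

/-- The neighbour of `v` behind port `i` of `v`. -/
def nbr (v : V) (i : Fin (P.deg v)) : V := (P.port v i).1

/-- The port of the neighbour `u = P.nbr v i` that leads back from `u` to `v`. -/
def back (v : V) (i : Fin (P.deg v)) : Fin (P.deg (P.nbr v i)) :=
  (P.port (P.nbr v i)).symm ⟨v, (P.port v i).2.symm⟩

end PortNumbering

/-- A randomized algorithm in the LOCAL model, where every node has an input in `I` and
an output in `O`. States, messages and local computations are arbitrary.

* `init n d x s` is the initial state of a node of degree `d` with input `x` and private random
  seed `s` in a network of `n` nodes. A node knows nothing else about the network: it has no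
  identifier, and it sees neither the graph nor the inputs or seeds of other nodes.
* `send q i` is the message that a node in state `q` sends through its port `i`.
* `recv q d m` is the new state of a node of degree `d` that was in state `q` and received
  message `m i` through its port `i`, for every `i`.
* `out q` is the output of a node that stops in state `q`. -/
structure LocalAlgorithm (I O : Type) where
  State : Type
  Msg : Type
  init : (n d : ℕ) → I → unitInterval → State
  send : State → ℕ → Msg
  recv : State → (d : ℕ) → (Fin d → Msg) → State
  out : State → O

namespace LocalAlgorithm

variable {I O : Type} (A : LocalAlgorithm I O)
  {V : Type} [Fintype V] {G : SimpleGraph V} (P : PortNumbering G)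

/-- The state of every node after `t` synchronous rounds, given the inputs `x` and seeds `s`. -/
def stateAfter (x : V → I) (s : V → unitInterval) : ℕ → V → A.State
  | 0, v => A.init (Fintype.card V) (P.deg v) (x v) (s v)
  | t + 1, v => A.recv (stateAfter x s t v) (P.deg v)
      fun i => A.send (stateAfter x s t (P.nbr v i)) (P.back v i)

/-- The output of every node when the algorithm is stopped after `t` rounds. -/
def outputAfter (x : V → I) (s : V → unitInterval) (t : ℕ) (v : V) : O :=
  A.out (A.stateAfter P x s t v)

end LocalAlgorithm

/-- The law of the private randomness: every node has an independent seed, uniform in `[0,1]`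
(which carries the same randomness as an infinite sequence of independent fair coin flips). -/
noncomputable def seedMeasure (V : Type) [Fintype V] : MeasureTheory.Measure (V → unitInterval) :=
  MeasureTheory.Measure.pi fun _ => MeasureTheory.volume

/-- `S` is a vertex cover of `G` whose weight is at most `a` times the weight of every
vertex cover of `G`, equivalently at most `a` times the minimum weight of a vertex cover. -/
def IsApproxMinWeightVertexCover {V : Type} [Fintype V] (G : SimpleGraph V) (w : V → ℝ≥0)
    (a : ℝ) (S : Finset V) : Prop :=
  G.IsVertexCover (S : Set V) ∧
    ∀ S' : Finset V, G.IsVertexCover (S' : Set V) →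
      ((∑ v ∈ S, w v : ℝ≥0) : ℝ) ≤ a * ((∑ v ∈ S', w v : ℝ≥0) : ℝ)

/-! Randomness only breaks symmetry: almost surely the seeds are distinct
(`seedMeasure_not_injective`) and serve as identifiers. Every node then gathers its neighbourhood
(`agree_gossip`) and simulates the deterministic process `Net.run`, whose remaining weights at time
`t` depend only on radius `A.m + 2 + t` (`Net.run_eq_of_agree`).

The process spends node weights on an edge packing. The cover consists of the nodes left with at
most a `δ` fraction of their weight. A packed edge has at most two ends in this cover and at least
one in any competitor, which gives the ratio `2 / (1 - δ)` (`Net.sum_wt_le_of_tight`).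

For speed, each edge gets a scale `r ≤ m` at which the balls `B_r` around it satisfy `log (|B_{r+1}|
/ |B_r|) ≤ log n / (r H_m)`, where `H_m` is the harmonic number (`Net.IsGraphOn.scale_spec`). Every
`O(r)` rounds each cluster `(x, r)` computes a maximal packing of its edges of scale `r`. A node
splits its offer among clusters in proportion to priorities, and multiplies by `K` the priority of
each cluster that exhausts its share.

While both ends of an edge are awake, each cluster centred in `B_r` triggers a raise at one end per
period, so the sum of log-priorities gains `|B_r| log K` (`Net.edgePotential_add_period`). Raises
cost weight (`Net.log_totalPrio_step_le`); by concavity, at an end that keeps more than a `δ`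
fraction, the average log-priority is at most `log (|B_{r+1}| / |B_r|) + 4 m (K - 1) log (1 / δ)`
(`Net.sum_log_prio_le`). So `O(log n / (r H_m log K))` periods of length `O(r)` suffice up to
lower-order terms: `r` cancels, and `H_m` and `log K` are each of order `log log n`. Periods lost
because an end sleeps are few, since sleeping means that half the weight held at the last restart is
gone (`Net.superperiods_le`). -/

/-! ### Finite maximal packings -/

section Packing

variable {U : Type} [DecidableEq U]

/-- The total value that `y` puts on the edges of `E` at `v`. -/
noncomputable def loadOn (E : Finset (Sym2 U)) (y : Sym2 U → ℝ) (v : U) : ℝ :=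
  ∑ e ∈ E with v ∈ e, y e

/-- `y` is an edge packing of `E` for the capacities `cap`, and every edge has an endpoint
whose capacity is exhausted. -/
structure IsMaximalPacking (E : Finset (Sym2 U)) (cap : U → ℝ) (y : Sym2 U → ℝ) : Prop where
  nonneg : ∀ e, 0 ≤ y e
  load_le : ∀ v, loadOn E y v ≤ cap v
  saturated : ∀ e ∈ E, ∃ v ∈ e, loadOn E y v = cap v

/-- Greedy: each inserted edge takes the smaller residual capacity of its ends, which exhausts one
of them. Loads never decrease, so earlier saturation persists. -/
theorem exists_isMaximalPacking (E : Finset (Sym2 U)) {cap : U → ℝ} (hcap : ∀ v, 0 ≤ cap v) :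
    ∃ y, IsMaximalPacking E cap y := by
  induction E using Finset.induction_on with
  | empty => exact ⟨fun _ => 0, fun _ => le_rfl, fun v => by simpa [loadOn] using hcap v, by simp⟩
  | insert e E he ih =>
    obtain ⟨y, hy⟩ := ih
    induction e using Sym2.ind with | _ a b =>
    set d := min (cap a - loadOn E y a) (cap b - loadOn E y b) with hd
    have hd0 : 0 ≤ d := le_min (sub_nonneg.2 (hy.load_le a)) (sub_nonneg.2 (hy.load_le b))
    have hload : ∀ v, loadOn (insert s(a, b) E) (Function.update y s(a, b) d) v =
        loadOn E y v + if v ∈ s(a, b) then d else 0 := by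
      intro v
      have hE : ∑ e ∈ E with v ∈ e, Function.update y s(a, b) d e = loadOn E y v :=
        Finset.sum_congr rfl fun e h => Function.update_of_ne
          (fun h' => he (by rw [← h']; exact (Finset.mem_filter.1 h).1)) _ _
      unfold loadOn
      rw [Finset.filter_insert]
      split_ifs with hv
      · rw [Finset.sum_insert (fun h => he (Finset.mem_filter.1 h).1), hE,
          Function.update_self, add_comm]
        rfl
      · rw [hE, add_zero]; rfl
    have hle : ∀ v, loadOn (insert s(a, b) E) (Function.update y s(a, b) d) v ≤ cap v := by
      intro v
      rw [hload]
      split_ifs with hv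
      · rcases Sym2.mem_iff.1 hv with rfl | rfl
        · linarith [min_le_left (cap v - loadOn E y v) (cap b - loadOn E y b)]
        · linarith [min_le_right (cap a - loadOn E y a) (cap v - loadOn E y v)]
      · simpa using hy.load_le v
    refine ⟨Function.update y s(a, b) d, ?_, hle, ?_⟩
    · intro e
      by_cases h : e = s(a, b)
      · subst h; simpa using hd0
      · simpa [Function.update_of_ne h] using hy.nonneg e
    · intro e h
      rcases Finset.mem_insert.1 h with rfl | h
      · rcases min_choice (cap a - loadOn E y a) (cap b - loadOn E y b) with h | h
        · exact ⟨a, by simp, by rw [hload]; simp [hd, h]⟩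
        · exact ⟨b, by simp, by rw [hload]; simp [hd, h]⟩
      · obtain ⟨v, hv, hs⟩ := hy.saturated e h
        refine ⟨v, hv, le_antisymm (hle v) ?_⟩
        rw [hload, hs]
        split_ifs <;> simp [hd0]

open Classical in
/-- A maximal packing chosen as a function of the edges and the capacities only. -/
noncomputable def maximalPacking (E : Finset (Sym2 U)) (cap : U → ℝ) : Sym2 U → ℝ :=
  if h : ∃ y, IsMaximalPacking E cap y then h.choose else fun _ => 0

theorem isMaximalPacking_maximalPacking (E : Finset (Sym2 U)) {cap : U → ℝ}
    (hcap : ∀ v, 0 ≤ cap v) : IsMaximalPacking E cap (maximalPacking E cap) := by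
  have h := exists_isMaximalPacking E hcap
  rw [maximalPacking, dif_pos h]
  exact h.choose_spec

theorem loadOn_nonneg {E : Finset (Sym2 U)} {y : Sym2 U → ℝ} (hy : ∀ e, 0 ≤ y e) (v : U) :
    0 ≤ loadOn E y v :=
  Finset.sum_nonneg fun e _ => hy e

/-- Every edge has at most two endpoints in `S`, and at least one in a vertex cover `S'`. -/
theorem sum_loadOn_le_two_mul {E : Finset (Sym2 U)} {y : Sym2 U → ℝ} (hy : ∀ e, 0 ≤ y e)
    (S S' : Finset U) (hS' : ∀ e ∈ E, ∃ v ∈ S', v ∈ e) :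
    ∑ v ∈ S, loadOn E y v ≤ 2 * ∑ v ∈ S', loadOn E y v := by
  have hswap : ∀ S : Finset U, ∑ v ∈ S, loadOn E y v =
      ∑ e ∈ E, ((S.filter (· ∈ e)).card : ℝ) * y e := by
    intro S
    simp only [loadOn, Finset.sum_filter]
    rw [Finset.sum_comm]
    refine Finset.sum_congr rfl fun e _ => ?_
    rw [← Finset.sum_filter, Finset.sum_const, nsmul_eq_mul]
  rw [hswap, hswap, Finset.mul_sum]
  refine Finset.sum_le_sum fun e he => ?_
  have h1 : ((S.filter (· ∈ e)).card : ℝ) ≤ 2 := by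
    have : (S.filter (· ∈ e)).card ≤ 2 := by
      induction e using Sym2.ind with | _ a b =>
      refine le_trans (Finset.card_le_card (t := {a, b}) fun v hv => ?_) Finset.card_le_two
      simpa using (Finset.mem_filter.1 hv).2
    exact_mod_cast this
  have h2 : (1 : ℝ) ≤ ((S'.filter (· ∈ e)).card : ℝ) := by
    obtain ⟨v, hv, hve⟩ := hS' e he
    exact_mod_cast Finset.card_pos.2 ⟨v, Finset.mem_filter.2 ⟨hv, hve⟩⟩
  nlinarith [hy e, mul_le_mul_of_nonneg_right h1 (hy e), mul_le_mul_of_nonneg_right h2 (hy e)]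

end Packing

/-! ### Weighted networks with identifiers -/

/-- Neighbourhoods and weights of nodes that are named by the elements of `U`. -/
structure Net (U : Type) where
  nb : U → Finset U
  wt : U → ℝ

namespace Net

variable {U : Type} [DecidableEq U] (N N' : Net U)

/-- The nodes at distance at most `k` from `v`. -/
def ball (v : U) : ℕ → Finset U
  | 0 => {v}
  | k + 1 => ball v k ∪ (ball v k).biUnion N.nb

variable {N N'}

theorem self_mem_ball (v : U) (k : ℕ) : v ∈ N.ball v k := by
  induction k with
  | zero => simp [ball]
  | succ k ih => simp [ball, ih]

theorem ball_mono (v : U) : Monotone (N.ball v) :=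
  monotone_nat_of_le_succ fun _ => Finset.subset_union_left

theorem mem_ball_of_mem_nb {v a b : U} {k : ℕ} (ha : a ∈ N.ball v k) (hb : b ∈ N.nb a) :
    b ∈ N.ball v (k + 1) :=
  Finset.mem_union_right _ (Finset.mem_biUnion.2 ⟨a, ha, hb⟩)

theorem mem_ball_trans {v u x : U} {j k : ℕ} (hu : u ∈ N.ball v j) (hx : x ∈ N.ball u k) :
    x ∈ N.ball v (j + k) := by
  induction k generalizing x with
  | zero => simp only [ball, Finset.mem_singleton] at hx; exact hx ▸ hu
  | succ k ih =>
    simp only [ball, Finset.mem_union, Finset.mem_biUnion] at hx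
    rcases hx with hx | ⟨a, ha, hx⟩
    · exact ball_mono v (by omega) (ih hx)
    · exact mem_ball_of_mem_nb (ih ha) hx

variable (N N') in
/-- `N` and `N'` have the same neighbourhoods and weights at distance at most `k` from `v`. -/
def Agree (v : U) (k : ℕ) : Prop :=
  ∀ u ∈ N.ball v k, N.nb u = N'.nb u ∧ N.wt u = N'.wt u

theorem Agree.mono {v : U} {j k : ℕ} (h : Agree N N' v k) (hjk : j ≤ k) : Agree N N' v j :=
  fun u hu => h u (ball_mono v hjk hu)

theorem Agree.of_mem {v u : U} {i j k : ℕ} (h : Agree N N' v k) (hu : u ∈ N.ball v i)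
    (hk : i + j ≤ k) : Agree N N' u j :=
  fun _ hx => h.mono hk _ (mem_ball_trans hu hx)

theorem Agree.ball_eq {v : U} {j k : ℕ} (h : Agree N N' v k) (hj : j ≤ k + 1) :
    N.ball v j = N'.ball v j := by
  induction j with
  | zero => rfl
  | succ j ih =>
    have ih := ih (by omega)
    rw [ball, ball, ← ih]
    congr 1
    exact Finset.biUnion_congr rfl fun a ha => (h a (ball_mono v (by omega) ha)).1

end Net

/-! ### The packing process -/

/-- Parameters: `n` bounds the number of nodes, `m` is the largest radius of a cluster, and `K`
is the factor by which priorities grow. -/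
structure ProcessParams where
  n : ℕ
  m : ℕ
  K : ℝ

/-- The state of a node: the remaining weight, its value at the last common restart, the priority
of every cluster `(x, r)`, and whether the node takes part in the current period of scale `r`. -/
structure NodeState (U : Type) where
  rem : ℝ
  ref : ℝ
  prio : ℕ → U → ℝ
  awake : ℕ → Prop

/-- The length of the periods of clusters of radius `r`. -/
def period (r : ℕ) : ℕ := 2 ^ Nat.clog 2 (2 * r + 2)

theorem period_pos (r : ℕ) : 0 < period r := by unfold period; positivity

/-- A node is within `r + 1` of the centres of its clusters, and so within `2 * r + 2` of all nodes
that matter to them: a period leaves time to collect their states. -/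
theorem le_period (r : ℕ) : 2 * r + 2 ≤ period r := Nat.le_pow_clog one_lt_two _

/-- Rounding lengths up to powers of two nests the periods, so that restarts occur at period ends of
every scale. -/
theorem period_dvd {r m : ℕ} (h : r ≤ m) : period r ∣ period m :=
  pow_dvd_pow _ (Nat.clog_mono_right _ (by omega))

theorem period_le {r : ℕ} (hr : 1 ≤ r) : period r ≤ 8 * r := by
  have h := Nat.pow_pred_clog_lt_self one_lt_two (x := 2 * r + 2) (by omega)
  have h0 : 0 < Nat.clog 2 (2 * r + 2) := Nat.clog_pos one_lt_two (by omega)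
  have : period r = 2 * 2 ^ (Nat.clog 2 (2 * r + 2)).pred := by
    rw [period, ← pow_succ', Nat.pred_eq_sub_one, Nat.sub_add_cancel h0]
  omega

namespace Net

variable {U : Type} [DecidableEq U] (N N' : Net U) (A : ProcessParams)

/-- The number of nodes at distance at most `r` from the edge `ab`. -/
def edgeBallCard (a b : U) (r : ℕ) : ℕ := (N.ball a r ∪ N.ball b r).card

/-- The scale of an edge: a radius where the balls around the edge grow slowly. -/
noncomputable def scale (a b : U) : ℕ :=
  sInf {r | r ∈ Finset.Icc 1 A.m ∧
    r * (∑ i ∈ Finset.Icc 1 A.m, (i : ℝ)⁻¹) *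
      Real.log (N.edgeBallCard a b (r + 1) / N.edgeBallCard a b r) ≤ Real.log A.n}

/-- The sum of the priorities of all clusters of radius `r` near `v`. -/
noncomputable def totalPrio (q : NodeState U) (v : U) (r : ℕ) : ℝ :=
  ∑ z ∈ N.ball v (r + 1), q.prio r z

open Classical in
/-- The part of its weight that `v` offers to the cluster `(x, r)`. -/
noncomputable def share (q : NodeState U) (v : U) (r : ℕ) (x : U) : ℝ :=
  if q.awake r ∧ x ∈ N.ball v (r + 1) then
    q.ref / (4 * A.m) * (q.prio r x / N.totalPrio q v r) else 0

open Classical in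
/-- The edges of scale `r` between nodes that are awake, at distance at most `r` from `x`. -/
noncomputable def clusterEdges (σ : U → NodeState U) (x : U) (r : ℕ) : Finset (Sym2 U) :=
  (N.ball x r).biUnion fun a =>
    ((N.nb a).filter fun b => N.scale A a b = r ∧ (σ a).awake r ∧ (σ b).awake r).image
      fun b => s(a, b)

/-- The capacities in the cluster `(x, r)`. -/
noncomputable def clusterCap (σ : U → NodeState U) (x : U) (r : ℕ) (u : U) : ℝ :=
  if u ∈ N.ball x (r + 1) then N.share A (σ u) u r x else 0

/-- The load that the packing of the cluster `(x, r)` puts on `v`. -/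
noncomputable def clusterLoad (σ : U → NodeState U) (x : U) (r : ℕ) (v : U) : ℝ :=
  loadOn (N.clusterEdges A σ x r)
    (maximalPacking (N.clusterEdges A σ x r) (N.clusterCap A σ x r)) v

/-- The radii whose periods end at time `t + 1`. -/
def dueScales (t : ℕ) : Finset ℕ := (Finset.Icc 1 A.m).filter fun r => period r ∣ t + 1

/-- The remaining weight of `v` after the packings that are due at time `t + 1`. -/
noncomputable def nextRem (σ : U → NodeState U) (t : ℕ) (v : U) : ℝ :=
  (σ v).rem - ∑ r ∈ dueScales A t, ∑ x ∈ N.ball v (r + 1), N.clusterLoad A σ x r v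

/-- The reference weight of `v` at time `t + 1`. -/
noncomputable def nextRef (σ : U → NodeState U) (t : ℕ) (v : U) : ℝ :=
  if period A.m ∣ t + 1 then N.nextRem A σ t v else (σ v).ref

open Classical in
/-- One time step of the process. -/
noncomputable def step (σ : U → NodeState U) (t : ℕ) (v : U) : NodeState U where
  rem := N.nextRem A σ t v
  ref := N.nextRef A σ t v
  prio r x := if period r ∣ t + 1 ∧ (σ v).awake r ∧ x ∈ N.ball v (r + 1) ∧
      N.share A (σ v) v r x ≤ N.clusterLoad A σ x r v
    then A.K * (σ v).prio r x else (σ v).prio r x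
  -- At a restart the two weights coincide, so a node with nonnegative remaining weight wakes up on
  -- all scales up to `A.m`.
  awake r := if period r ∣ t + 1 then N.nextRef A σ t v / 2 ≤ N.nextRem A σ t v
    else (σ v).awake r

/-- The states of all nodes at time `t`. -/
noncomputable def run : ℕ → U → NodeState U
  | 0 => fun v => ⟨N.wt v, N.wt v, fun _ _ => 1, fun _ => True⟩
  | t + 1 => N.step A (run t) t

/-! ### Locality of the process -/

variable {N N' A}

theorem Agree.scale_eq {a b : U} (ha : Agree N N' a A.m) (hb : Agree N N' b A.m) :
    N.scale A a b = N'.scale A a b := by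
  unfold scale
  congr 1
  ext r
  simp only [Set.mem_ofPred_eq]
  refine and_congr_right fun hr => ?_
  have hr := (Finset.mem_Icc.1 hr).2
  simp only [edgeBallCard, ha.ball_eq (j := r) (by omega), hb.ball_eq (j := r) (by omega),
    ha.ball_eq (j := r + 1) (by omega), hb.ball_eq (j := r + 1) (by omega)]

theorem Agree.share_eq {q q' : NodeState U} {v : U} {r : ℕ} (h : Agree N N' v r)
    (href : q.ref = q'.ref) (hprio : q.prio r = q'.prio r) (hawake : q.awake r ↔ q'.awake r)
    (x : U) : N.share A q v r x = N'.share A q' v r x := by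
  classical
  unfold share totalPrio
  rw [h.ball_eq le_rfl, href, hprio]
  exact if_congr (by rw [hawake]) rfl rfl

theorem Agree.clusterLoad_eq {σ σ' : U → NodeState U} {x : U} {r : ℕ} (hrm : r ≤ A.m)
    (h : Agree N N' x (A.m + r + 2))
    (href : ∀ u ∈ N.ball x (r + 1), (σ u).ref = (σ' u).ref)
    (hprio : ∀ u ∈ N.ball x (r + 1), (σ u).prio r = (σ' u).prio r)
    (hawake : ∀ u ∈ N.ball x (r + 1), (σ u).awake r ↔ (σ' u).awake r) :
    N.clusterLoad A σ x r = N'.clusterLoad A σ' x r := by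
  classical
  have hE : N.clusterEdges A σ x r = N'.clusterEdges A σ' x r := by
    unfold clusterEdges
    refine Finset.biUnion_congr (h.ball_eq (by omega)) fun a ha => ?_
    have ha' := ball_mono x (Nat.le_succ r) ha
    rw [← (h.of_mem ha (j := 0) (by omega) a (self_mem_ball a 0)).1]
    congr 1
    refine Finset.filter_congr fun b hb => ?_
    have hb' := mem_ball_of_mem_nb ha hb
    rw [(h.of_mem ha (by omega)).scale_eq (h.of_mem hb' (by omega)), hawake a ha', hawake b hb']
  have hcap : N.clusterCap A σ x r = N'.clusterCap A σ' x r := by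
    ext u
    unfold clusterCap
    rw [← h.ball_eq (by omega)]
    split_ifs with hu
    · exact (h.of_mem hu (by omega)).share_eq (href u hu) (hprio u hu) (hawake u hu) x
    · rfl
  ext v
  rw [clusterLoad, clusterLoad, hE, hcap]

/-- With `a = period r` and `b = period A.m`: the last restart is no later than the start of the
current period, so reference weights need no larger radius than priorities. -/
theorem mul_div_le_of_dvd {a b : ℕ} (h : a ∣ b) (t : ℕ) : b * (t / b) ≤ a * (t / a) := by
  obtain ⟨c, rfl⟩ := h
  rw [mul_assoc, ← Nat.div_div_eq_div_mul]
  exact Nat.mul_le_mul_left _ (Nat.mul_div_le _ _)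

theorem mul_succ_div_of_dvd {k t : ℕ} (h : k ∣ t + 1) :
    k * ((t + 1) / k) = t + 1 ∧ k * (t / k) + k = t + 1 := by
  have h1 := Nat.mul_div_cancel' h
  refine ⟨h1, ?_⟩
  rw [Nat.succ_div_of_dvd h] at h1
  linarith [h1]

/-- The remaining weight of `v` at time `t` depends on the network at distance at most
`A.m + 2 + t` only; offers depend on the network as seen at the beginning of their period. -/
theorem run_eq_of_agree (t : ℕ) :
    (∀ v, Agree N N' v (A.m + 2 + t) → (N.run A t v).rem = (N'.run A t v).rem) ∧
    (∀ v, Agree N N' v (A.m + 2 + period A.m * (t / period A.m)) →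
      (N.run A t v).ref = (N'.run A t v).ref) ∧
    (∀ r ∈ Finset.Icc 1 A.m, ∀ v, Agree N N' v (A.m + 2 + period r * (t / period r)) →
      (N.run A t v).prio r = (N'.run A t v).prio r ∧
      ((N.run A t v).awake r ↔ (N'.run A t v).awake r)) := by
  classical
  induction t with
  | zero =>
    refine ⟨fun v h => (h v (self_mem_ball v _)).2, fun v h => (h v (self_mem_ball v _)).2,
      fun r _ v _ => ⟨rfl, Iff.rfl⟩⟩
  | succ t ih =>
    obtain ⟨ihrem, ihref, ihr⟩ := ih
    have hload : ∀ r ∈ Finset.Icc 1 A.m, period r ∣ t + 1 → ∀ v, Agree N N' v (A.m + 2 + (t + 1)) →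
        ∀ x ∈ N.ball v (r + 1),
          N.clusterLoad A (N.run A t) x r v = N'.clusterLoad A (N'.run A t) x r v := by
      intro r hr hd v hv x hx
      have hrm := (Finset.mem_Icc.1 hr).2
      have h1 := mul_succ_div_of_dvd hd
      have h2 := le_period r
      have h3 := mul_div_le_of_dvd (period_dvd hrm) t
      -- The distance from `v` to `u` is at most `2 * r + 2 ≤ period r`, which the time elapsed
      -- since the start of the period pays for.
      have hu : ∀ u ∈ N.ball x (r + 1), Agree N N' u (A.m + 2 + period r * (t / period r)) :=
        fun u hu => hv.of_mem (mem_ball_trans hx hu) (by omega)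
      exact congrFun (Agree.clusterLoad_eq hrm (hv.of_mem hx (by omega))
        (fun u h => ihref u ((hu u h).mono (by omega))) (fun u h => (ihr r hr u (hu u h)).1)
        (fun u h => (ihr r hr u (hu u h)).2)) v
    have hrem : ∀ v, Agree N N' v (A.m + 2 + (t + 1)) →
        N.nextRem A (N.run A t) t v = N'.nextRem A (N'.run A t) t v := by
      intro v hv
      unfold nextRem
      rw [ihrem v (hv.mono (by omega))]
      congr 1
      refine Finset.sum_congr rfl fun r hr => ?_
      obtain ⟨hr, hd⟩ := Finset.mem_filter.1 hr
      have hrm := (Finset.mem_Icc.1 hr).2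
      rw [← hv.ball_eq (by omega)]
      exact Finset.sum_congr rfl fun x hx => hload r hr hd v hv x hx
    have href : ∀ v, Agree N N' v (A.m + 2 + period A.m * ((t + 1) / period A.m)) →
        N.nextRef A (N.run A t) t v = N'.nextRef A (N'.run A t) t v := by
      intro v hv
      unfold nextRef
      split_ifs with hd
      · exact hrem v (hv.mono (by rw [(mul_succ_div_of_dvd hd).1]))
      · rw [Nat.succ_div_of_not_dvd hd] at hv
        exact ihref v hv
    refine ⟨hrem, href, fun r hr v hv => ?_⟩
    have hrm := (Finset.mem_Icc.1 hr).2
    by_cases hd : period r ∣ t + 1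
    · have h1 := mul_succ_div_of_dvd hd
      have h3 := mul_div_le_of_dvd (period_dvd hrm) t
      have h4 := mul_div_le_of_dvd (period_dvd hrm) (t + 1)
      rw [h1.1] at hv
      have hv' := ihr r hr v (hv.mono (by omega))
      refine ⟨?_, ?_⟩
      · ext x
        simp only [run, step, hd, true_and]
        rw [hv'.2, ← hv.ball_eq (by omega), hv'.1,
          (hv.mono (by omega)).share_eq (ihref v (hv.mono (by omega))) hv'.1 hv'.2 x]
        refine if_congr (and_congr_right fun _ => and_congr_right fun hx => ?_) rfl rfl
        rw [hload r hr hd v hv x hx]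
      · simp only [run, step, hd, if_true]
        rw [hrem v hv, href v (hv.mono (by omega))]
    · rw [Nat.succ_div_of_not_dvd hd] at hv
      have hv' := ihr r hr v hv
      simp only [run, step, hd, false_and, if_false]
      exact hv'

end Net

/-! ### Symmetry of balls and existence of the scale of an edge. -/

namespace Net

variable {U : Type} [DecidableEq U]

/-- `N` is a simple graph with nonnegative weights whose non-isolated nodes lie in `V`. -/
structure IsGraphOn (N : Net U) (V : Finset U) : Prop where
  symm : ∀ a, ∀ b ∈ N.nb a, a ∈ N.nb b
  nb_subset : ∀ a, N.nb a ⊆ V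
  wt_nonneg : ∀ a, 0 ≤ N.wt a

variable {N : Net U} {V : Finset U} {A : ProcessParams}

namespace IsGraphOn

theorem mem_ball_of_mem_ball (h : N.IsGraphOn V) {v x : U} {k : ℕ} (hx : x ∈ N.ball v k) :
    v ∈ N.ball x k := by
  induction k generalizing x with
  | zero => simpa [ball, eq_comm] using hx
  | succ k ih =>
    simp only [ball, Finset.mem_union, Finset.mem_biUnion] at hx
    rcases hx with hx | ⟨a, ha, hx⟩
    · exact ball_mono x (Nat.le_succ k) (ih hx)
    · have h1 : a ∈ N.ball x 1 := mem_ball_of_mem_nb (self_mem_ball x 0) (h.symm a x hx)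
      have := mem_ball_trans h1 (ih ha)
      rwa [add_comm] at this

theorem mem_ball_comm (h : N.IsGraphOn V) {v x : U} {k : ℕ} :
    x ∈ N.ball v k ↔ v ∈ N.ball x k :=
  ⟨h.mem_ball_of_mem_ball, h.mem_ball_of_mem_ball⟩

theorem ball_subset (h : N.IsGraphOn V) {v : U} (hv : v ∈ V) (k : ℕ) : N.ball v k ⊆ V := by
  induction k with
  | zero => simpa [ball] using hv
  | succ k ih => exact Finset.union_subset ih (Finset.biUnion_subset.2 fun a _ => h.nb_subset a)

omit [DecidableEq U] in
theorem left_mem (h : N.IsGraphOn V) {a b : U} (hb : b ∈ N.nb a) : a ∈ V :=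
  h.nb_subset b (h.symm a b hb)

end IsGraphOn

theorem edgeBallCard_comm (a b : U) (r : ℕ) : N.edgeBallCard a b r = N.edgeBallCard b a r := by
  rw [edgeBallCard, Finset.union_comm, edgeBallCard]

theorem scale_comm (a b : U) : N.scale A a b = N.scale A b a := by
  simp only [scale, edgeBallCard_comm (N := N) a b]

theorem edgeBallCard_pos (a b : U) (r : ℕ) : 0 < N.edgeBallCard a b r :=
  Finset.card_pos.2 ⟨a, Finset.mem_union_left _ (self_mem_ball a r)⟩

/-- The growth of the balls around an edge is small, relative to the radius, at some radius. -/
theorem IsGraphOn.scale_spec (h : N.IsGraphOn V) (hV : V.card ≤ A.n) (hm : 1 ≤ A.m) {a b : U}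
    (hb : b ∈ N.nb a) :
    N.scale A a b ∈ Finset.Icc 1 A.m ∧
    (N.scale A a b) * (∑ i ∈ Finset.Icc 1 A.m, (i : ℝ)⁻¹) *
      Real.log (N.edgeBallCard a b (N.scale A a b + 1) / N.edgeBallCard a b (N.scale A a b)) ≤
        Real.log A.n := by
  refine Nat.sInf_mem (s := {r | r ∈ Finset.Icc 1 A.m ∧
    r * (∑ i ∈ Finset.Icc 1 A.m, (i : ℝ)⁻¹) *
      Real.log (N.edgeBallCard a b (r + 1) / N.edgeBallCard a b r) ≤ Real.log A.n}) ?_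
  -- Otherwise the logarithmic growths would sum to more than `log n`, while they telescope to at
  -- most the logarithm of a ball inside `V`.
  by_contra hne
  rw [Set.not_nonempty_iff_eq_empty, Set.eq_empty_iff_forall_notMem] at hne
  set H := ∑ i ∈ Finset.Icc 1 A.m, (i : ℝ)⁻¹ with hH
  have hHpos : 0 < H := Finset.sum_pos
    (fun i hi => by have := (Finset.mem_Icc.1 hi).1; positivity) ⟨1, by simpa using hm⟩
  have hpos : ∀ r, (0 : ℝ) < N.edgeBallCard a b r := fun r => by
    exact_mod_cast edgeBallCard_pos a b r
  have hlt : ∑ r ∈ Finset.Icc 1 A.m, Real.log A.n / H * (r : ℝ)⁻¹ <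
      ∑ r ∈ Finset.Icc 1 A.m,
        Real.log (N.edgeBallCard a b (r + 1) / N.edgeBallCard a b r) := by
    refine Finset.sum_lt_sum_of_nonempty ⟨1, by simpa using hm⟩ fun r hr => ?_
    have h1 := hne r
    simp only [Set.mem_ofPred_eq, not_and, not_le] at h1
    have hr0 : (0 : ℝ) < r := by exact_mod_cast (Finset.mem_Icc.1 hr).1
    have := h1 hr
    rw [← div_eq_mul_inv, div_div, div_lt_iff₀ (by positivity)]
    linarith
  rw [← Finset.mul_sum, ← hH, div_mul_cancel₀ _ hHpos.ne'] at hlt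
  have htel : ∀ m : ℕ, ∑ r ∈ Finset.Icc 1 m,
      Real.log (N.edgeBallCard a b (r + 1) / N.edgeBallCard a b r) =
      Real.log (N.edgeBallCard a b (m + 1)) - Real.log (N.edgeBallCard a b 1) := by
    intro m
    induction m with
    | zero => simp
    | succ m ih =>
      rw [Finset.sum_Icc_succ_top (by omega), ih, Real.log_div (hpos _).ne' (hpos _).ne']
      ring
  rw [htel] at hlt
  have hle : (N.edgeBallCard a b (A.m + 1) : ℝ) ≤ A.n := by
    exact_mod_cast (Finset.card_le_card (Finset.union_subset
      (h.ball_subset (h.left_mem hb) _) (h.ball_subset (h.nb_subset a hb) _))).trans hV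
  have h1 := Real.log_le_log (hpos _) hle
  have h2 : 0 ≤ Real.log (N.edgeBallCard a b 1) :=
    Real.log_nonneg (by exact_mod_cast edgeBallCard_pos a b 1)
  linarith

/-! ### One step of the process -/

/-- The total amount that a node in state `q` offers on scale `r`. -/
noncomputable def offer (A : ProcessParams) (q : NodeState U) (r : ℕ) : ℝ :=
  open Classical in if q.awake r then q.ref / (4 * A.m) else 0

/-- The invariants of the process at a single node. -/
structure StateOk (A : ProcessParams) (q : NodeState U) : Prop where
  ref_nonneg : 0 ≤ q.ref
  rem_le_ref : q.rem ≤ q.ref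
  one_le_prio : ∀ r x, 1 ≤ q.prio r x
  sum_offer_le : ∑ r ∈ Finset.Icc 1 A.m, offer A q r ≤ q.rem

omit [DecidableEq U] in
theorem StateOk.offer_nonneg {q : NodeState U} (hq : StateOk A q) (r : ℕ) : 0 ≤ offer A q r := by
  unfold offer
  have := hq.ref_nonneg
  split_ifs <;> positivity

omit [DecidableEq U] in
theorem StateOk.rem_nonneg {q : NodeState U} (hq : StateOk A q) : 0 ≤ q.rem :=
  (Finset.sum_nonneg fun r _ => hq.offer_nonneg r).trans hq.sum_offer_le

theorem StateOk.totalPrio_pos {q : NodeState U} (hq : StateOk A q) (v : U) (r : ℕ) :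
    0 < N.totalPrio q v r :=
  Finset.sum_pos (fun x _ => zero_lt_one.trans_le (hq.one_le_prio r x)) ⟨v, self_mem_ball v _⟩

theorem StateOk.share_nonneg {q : NodeState U} (hq : StateOk A q) (v : U) (r : ℕ) (x : U) :
    0 ≤ N.share A q v r x := by
  have h1 := hq.ref_nonneg
  have h2 := zero_lt_one.trans_le (hq.one_le_prio r x)
  have h3 := hq.totalPrio_pos (N := N) v r
  unfold share
  split_ifs <;> positivity

theorem StateOk.sum_share {q : NodeState U} (hq : StateOk A q) (v : U) (r : ℕ) :
    ∑ x ∈ N.ball v (r + 1), N.share A q v r x = offer A q r := by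
  have h3 := (hq.totalPrio_pos (N := N) v r).ne'
  unfold offer
  split_ifs with hr
  · have : ∀ x ∈ N.ball v (r + 1), N.share A q v r x =
        q.ref / (4 * A.m) * (q.prio r x / N.totalPrio q v r) := fun x hx => by
      rw [share, if_pos ⟨hr, hx⟩]
    rw [Finset.sum_congr rfl this, ← Finset.mul_sum, ← Finset.sum_div]
    change _ * (N.totalPrio q v r / N.totalPrio q v r) = _
    rw [div_self h3, mul_one]
  · exact Finset.sum_eq_zero fun x _ => by rw [share, if_neg fun h => hr h.1]

section Step

variable {σ : U → NodeState U} (hσ : ∀ u, StateOk A (σ u))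

include hσ

theorem clusterCap_nonneg (x : U) (r : ℕ) (u : U) : 0 ≤ N.clusterCap A σ x r u := by
  unfold clusterCap
  split_ifs
  · exact (hσ u).share_nonneg u r x
  · exact le_rfl

theorem isMaximalPacking_cluster (x : U) (r : ℕ) :
    IsMaximalPacking (N.clusterEdges A σ x r) (N.clusterCap A σ x r)
      (maximalPacking (N.clusterEdges A σ x r) (N.clusterCap A σ x r)) :=
  isMaximalPacking_maximalPacking _ (clusterCap_nonneg hσ x r)

theorem clusterLoad_nonneg (x : U) (r : ℕ) (v : U) : 0 ≤ N.clusterLoad A σ x r v :=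
  loadOn_nonneg (isMaximalPacking_cluster hσ x r).nonneg v

theorem clusterLoad_le_share (x : U) (r : ℕ) (v : U) :
    N.clusterLoad A σ x r v ≤ N.share A (σ v) v r x := by
  refine ((isMaximalPacking_cluster hσ x r).load_le v).trans ?_
  unfold clusterCap
  split_ifs
  · exact le_rfl
  · exact (hσ v).share_nonneg v r x

theorem sum_clusterLoad_le_offer (r : ℕ) (v : U) :
    ∑ x ∈ N.ball v (r + 1), N.clusterLoad A σ x r v ≤ offer A (σ v) r := by
  rw [← (hσ v).sum_share (N := N) v r]
  exact Finset.sum_le_sum fun x _ => clusterLoad_le_share hσ x r v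

theorem nextRem_le (t : ℕ) (v : U) : N.nextRem A σ t v ≤ (σ v).rem :=
  sub_le_self _ (Finset.sum_nonneg fun r _ => Finset.sum_nonneg fun x _ =>
    clusterLoad_nonneg hσ x r v)

/-- Offers on different scales overlap in time, so the weight must cover all of them at once. If at
least half the reference weight remains, all scales together offer at most a quarter of it.
Otherwise no new offer is made, and due packings take no more than was reserved for them. -/
theorem stateOk_step (hm : 1 ≤ A.m) (hK : 1 ≤ A.K) (t : ℕ) (v : U) :
    StateOk A (N.step A σ t v) := by
  classical
  have hm0 : (0 : ℝ) < A.m := by exact_mod_cast hm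
  have hv := hσ v
  have hrem : ∑ r ∈ (Finset.Icc 1 A.m).filter (fun r => ¬ period r ∣ t + 1), offer A (σ v) r ≤
      N.nextRem A σ t v := by
    have h1 := hv.sum_offer_le
    rw [← Finset.sum_filter_add_sum_filter_not _ (fun r => period r ∣ t + 1)] at h1
    have h2 : ∑ r ∈ dueScales A t, ∑ x ∈ N.ball v (r + 1), N.clusterLoad A σ x r v ≤
        ∑ r ∈ dueScales A t, offer A (σ v) r :=
      Finset.sum_le_sum fun r _ => sum_clusterLoad_le_offer hσ r v
    unfold nextRem
    unfold dueScales at h2 ⊢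
    linarith
  have hrem0 : 0 ≤ N.nextRem A σ t v :=
    (Finset.sum_nonneg fun r _ => hv.offer_nonneg r).trans hrem
  have href : 0 ≤ N.nextRef A σ t v := by
    unfold nextRef
    split_ifs
    · exact hrem0
    · exact hv.ref_nonneg
  refine ⟨href, ?_, ?_, ?_⟩
  · change N.nextRem A σ t v ≤ N.nextRef A σ t v
    unfold nextRef
    split_ifs
    · exact le_rfl
    · exact (nextRem_le hσ t v).trans hv.rem_le_ref
  · intro r x
    have := hv.one_le_prio r x
    simp only [step]
    split_ifs
    · nlinarith
    · exact this
  · change _ ≤ N.nextRem A σ t v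
    by_cases hbig : N.nextRef A σ t v / 2 ≤ N.nextRem A σ t v
    · calc ∑ r ∈ Finset.Icc 1 A.m, offer A (N.step A σ t v) r
          ≤ ∑ r ∈ Finset.Icc 1 A.m, N.nextRef A σ t v / (4 * A.m) := by
            refine Finset.sum_le_sum fun r _ => ?_
            unfold offer
            split_ifs
            · exact le_rfl
            · positivity
        _ = N.nextRef A σ t v / 4 := by
            rw [Finset.sum_const, Nat.card_Icc, nsmul_eq_mul]
            simp only [Nat.add_sub_cancel]
            field_simp
        _ ≤ N.nextRem A σ t v := by linarith
    -- A restart would make the test `hbig` trivially true; hence the reference weight, and with it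
    -- each unfinished offer, is unchanged.
    · have hM : ¬ period A.m ∣ t + 1 := by
        intro hM
        rw [nextRef, if_pos hM] at hbig
        exact hbig (by linarith)
      refine le_trans (le_of_eq ?_) hrem
      rw [Finset.sum_filter]
      refine Finset.sum_congr rfl fun r _ => ?_
      by_cases hd : period r ∣ t + 1
      · rw [if_neg (not_not.2 hd), offer, if_neg]
        simp only [step, hd, if_true]
        exact hbig
      · rw [if_pos hd]
        simp only [offer, step, hd, if_false, nextRef, hM]

/-- Priorities at `v` grow only at the expense of the remaining weight of `v`. -/
theorem log_totalPrio_step_le (hm : 1 ≤ A.m) (hK : 1 ≤ A.K) {t r : ℕ}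
    (hr : r ∈ Finset.Icc 1 A.m) {v : U} (hpos : 0 < N.nextRem A σ t v) :
    Real.log (N.totalPrio (N.step A σ t v) v r) + 4 * A.m * (A.K - 1) *
      Real.log (N.nextRem A σ t v) ≤
    Real.log (N.totalPrio (σ v) v r) + 4 * A.m * (A.K - 1) * Real.log (σ v).rem := by
  classical
  have hm0 : (0 : ℝ) < A.m := by exact_mod_cast hm
  have hv := hσ v
  have hle := nextRem_le (N := N) hσ t v
  have hrem : 0 < (σ v).rem := hpos.trans_le hle
  set P := N.totalPrio (σ v) v r with hP
  have hP0 : 0 < P := hv.totalPrio_pos v r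
  set Hs := (N.ball v (r + 1)).filter fun x => period r ∣ t + 1 ∧ (σ v).awake r ∧
    x ∈ N.ball v (r + 1) ∧ N.share A (σ v) v r x ≤ N.clusterLoad A σ x r v with hHs
  -- The fraction of the total priority that is raised: the total grows by the factor `1 + (K - 1)
  -- h`, while the weight loses at least its fraction `h / (4 m)`.
  set h := ∑ x ∈ Hs, (σ v).prio r x / P with hh
  have hh0 : 0 ≤ h := Finset.sum_nonneg fun x _ =>
    div_nonneg (zero_le_one.trans (hv.one_le_prio r x)) hP0.le
  have hP' : N.totalPrio (N.step A σ t v) v r = P * (1 + (A.K - 1) * h) := by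
    have h1 : P * h = ∑ x ∈ Hs, (σ v).prio r x := by
      rw [hh, ← Finset.sum_div, mul_div_cancel₀ _ hP0.ne']
    have h2 : N.totalPrio (N.step A σ t v) v r =
        ∑ x ∈ N.ball v (r + 1), ((σ v).prio r x + if (period r ∣ t + 1 ∧ (σ v).awake r ∧
          x ∈ N.ball v (r + 1) ∧ N.share A (σ v) v r x ≤ N.clusterLoad A σ x r v) then
          (A.K - 1) * (σ v).prio r x else 0) := by
      unfold totalPrio
      refine Finset.sum_congr rfl fun x _ => ?_
      simp only [step]
      split_ifs <;> ring
    rw [h2, Finset.sum_add_distrib, ← Finset.sum_filter, ← hHs, ← Finset.mul_sum, ← h1]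
    change P + _ = _
    ring
  have hrem' : N.nextRem A σ t v ≤ (σ v).rem - (σ v).rem / (4 * A.m) * h := by
    by_cases hne : Hs = ∅
    · simpa [hh, hne] using hle
    · obtain ⟨x₀, hx₀⟩ := Finset.nonempty_iff_ne_empty.2 hne
      obtain ⟨-, hd, hw, -⟩ := Finset.mem_filter.1 hx₀
      have h1 : (σ v).ref / (4 * A.m) * h ≤
          ∑ x ∈ N.ball v (r + 1), N.clusterLoad A σ x r v := by
        rw [hh, Finset.mul_sum]
        refine (Finset.sum_le_sum fun x hx => ?_).trans (Finset.sum_le_sum_of_subset_of_nonneg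
          (Finset.filter_subset _ _) fun x _ _ => clusterLoad_nonneg hσ x r v)
        obtain ⟨hxb, -, -, -, hx⟩ := Finset.mem_filter.1 hx
        rwa [share, if_pos ⟨hw, hxb⟩] at hx
      have h2 : ∑ x ∈ N.ball v (r + 1), N.clusterLoad A σ x r v ≤
          ∑ r ∈ dueScales A t, ∑ x ∈ N.ball v (r + 1), N.clusterLoad A σ x r v :=
        Finset.single_le_sum (f := fun r => ∑ x ∈ N.ball v (r + 1), N.clusterLoad A σ x r v)
          (fun r _ => Finset.sum_nonneg fun x _ => clusterLoad_nonneg hσ x r v)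
          (Finset.mem_filter.2 ⟨hr, hd⟩)
      have h3 : (σ v).rem / (4 * A.m) * h ≤ (σ v).ref / (4 * A.m) * h := by
        have := hv.rem_le_ref
        gcongr
      unfold nextRem
      linarith
  have hfac : 0 < 1 - h / (4 * A.m) := by
    have : 0 < (σ v).rem * (1 - h / (4 * A.m)) := by
      refine hpos.trans_le (hrem'.trans (le_of_eq ?_))
      ring
    exact pos_of_mul_pos_right this hrem.le
  have hlog : Real.log (N.nextRem A σ t v) ≤ Real.log (σ v).rem - h / (4 * A.m) := by
    have h1 : N.nextRem A σ t v ≤ (σ v).rem * (1 - h / (4 * A.m)) :=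
      hrem'.trans (le_of_eq (by ring))
    have h2 := Real.log_le_log hpos h1
    rw [Real.log_mul hrem.ne' hfac.ne'] at h2
    have h3 := Real.log_le_sub_one_of_pos hfac
    linarith
  have hK0 : 0 ≤ A.K - 1 := by linarith
  have hKh : 0 ≤ (A.K - 1) * h := mul_nonneg hK0 hh0
  have h4 : Real.log (1 + (A.K - 1) * h) ≤ (A.K - 1) * h := by
    have := Real.log_le_sub_one_of_pos (x := 1 + (A.K - 1) * h) (by linarith)
    linarith
  rw [hP', Real.log_mul hP0.ne' (by linarith)]
  have h5 : 4 * A.m * (A.K - 1) * Real.log (N.nextRem A σ t v) ≤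
      4 * A.m * (A.K - 1) * (Real.log (σ v).rem - h / (4 * A.m)) := by
    gcongr
  have h6 : 4 * A.m * (A.K - 1) * (Real.log (σ v).rem - h / (4 * A.m)) =
      4 * A.m * (A.K - 1) * Real.log (σ v).rem - (A.K - 1) * h := by
    field_simp
  linarith

theorem prio_le_step (hK : 1 ≤ A.K) (t r : ℕ) (v x : U) :
    (σ v).prio r x ≤ (N.step A σ t v).prio r x := by
  have := (hσ v).one_le_prio r x
  simp only [step]
  split_ifs
  · nlinarith
  · exact le_rfl

/-- In every cluster of an edge between nodes that are awake, one of the two nodes raises its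
priority. -/
theorem prio_step_of_awake (h : N.IsGraphOn V) {t r : ℕ} (hd : period r ∣ t + 1) {a b : U}
    (hb : b ∈ N.nb a) (hr : N.scale A a b = r) (ha : (σ a).awake r) (hb' : (σ b).awake r) {x : U}
    (hx : x ∈ N.ball a r ∪ N.ball b r) :
    (N.step A σ t a).prio r x = A.K * (σ a).prio r x ∨
      (N.step A σ t b).prio r x = A.K * (σ b).prio r x := by
  classical
  have hE : s(a, b) ∈ N.clusterEdges A σ x r := by
    unfold clusterEdges
    rw [Finset.mem_biUnion]
    rcases Finset.mem_union.1 hx with hx | hx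
    · exact ⟨a, h.mem_ball_comm.1 hx, Finset.mem_image.2
        ⟨b, Finset.mem_filter.2 ⟨hb, hr, ha, hb'⟩, rfl⟩⟩
    · exact ⟨b, h.mem_ball_comm.1 hx, Finset.mem_image.2
        ⟨a, Finset.mem_filter.2 ⟨h.symm a b hb, by rwa [scale_comm], hb', ha⟩, Sym2.eq_swap⟩⟩
  have hxa : x ∈ N.ball a (r + 1) ∧ x ∈ N.ball b (r + 1) := by
    have h1 : b ∈ N.ball a 1 := mem_ball_of_mem_nb (self_mem_ball a 0) hb
    have h2 : a ∈ N.ball b 1 := h.mem_ball_comm.1 h1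
    rcases Finset.mem_union.1 hx with hx | hx
    · exact ⟨ball_mono a (Nat.le_succ r) hx, ball_mono b (by omega) (mem_ball_trans h2 hx)⟩
    · exact ⟨ball_mono a (by omega) (mem_ball_trans h1 hx), ball_mono b (Nat.le_succ r) hx⟩
  have key : ∀ v, (σ v).awake r → x ∈ N.ball v (r + 1) →
      N.clusterLoad A σ x r v = N.clusterCap A σ x r v →
      (N.step A σ t v).prio r x = A.K * (σ v).prio r x := by
    intro v hv hxv hs
    rw [clusterCap, if_pos (h.mem_ball_comm.1 hxv)] at hs
    simp only [step]
    exact if_pos ⟨hd, hv, hxv, hs.ge⟩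
  obtain ⟨v, hv, hs⟩ := (isMaximalPacking_cluster hσ x r).saturated _ hE
  rcases Sym2.mem_iff.1 hv with rfl | rfl
  · exact Or.inl (key v ha hxa.1 hs)
  · exact Or.inr (key v hb' hxa.2 hs)

/-- The weight that a step takes from a set of nodes is at most twice what it takes from any
vertex cover. -/
theorem sum_rem_sub_nextRem_le (h : N.IsGraphOn V) (t : ℕ) {S S' : Finset U} (hS : S ⊆ V)
    (hS' : S' ⊆ V) (hcov : ∀ a, ∀ b ∈ N.nb a, a ∈ S' ∨ b ∈ S') :
    ∑ v ∈ S, ((σ v).rem - N.nextRem A σ t v) ≤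
      2 * ∑ v ∈ S', ((σ v).rem - N.nextRem A σ t v) := by
  classical
  -- Clusters too far from `v` put no load on it. Summing over all of `V` makes the range
  -- independent of `v`, so that the sums can be exchanged.
  have hext : ∀ v ∈ V, (σ v).rem - N.nextRem A σ t v =
      ∑ r ∈ dueScales A t, ∑ x ∈ V, N.clusterLoad A σ x r v := by
    intro v hv
    rw [nextRem, sub_sub_cancel]
    refine Finset.sum_congr rfl fun r _ => Finset.sum_subset (h.ball_subset hv _) fun x _ hx => ?_
    refine Finset.sum_eq_zero fun e he => absurd ?_ hx
    obtain ⟨he, hve⟩ := Finset.mem_filter.1 he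
    unfold clusterEdges at he
    obtain ⟨a, ha, he⟩ := Finset.mem_biUnion.1 he
    obtain ⟨b, hb, rfl⟩ := Finset.mem_image.1 he
    rw [h.mem_ball_comm]
    rcases Sym2.mem_iff.1 hve with rfl | rfl
    · exact ball_mono x (Nat.le_succ r) ha
    · exact mem_ball_of_mem_nb ha (Finset.mem_filter.1 hb).1
  have hswap : ∀ S ⊆ V, ∑ v ∈ S, ((σ v).rem - N.nextRem A σ t v) =
      ∑ r ∈ dueScales A t, ∑ x ∈ V, ∑ v ∈ S, N.clusterLoad A σ x r v := by
    intro S hS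
    rw [Finset.sum_congr rfl fun v hv => hext v (hS hv), Finset.sum_comm]
    exact Finset.sum_congr rfl fun r _ => Finset.sum_comm
  rw [hswap S hS, hswap S' hS', Finset.mul_sum]
  refine Finset.sum_le_sum fun r _ => ?_
  rw [Finset.mul_sum]
  refine Finset.sum_le_sum fun x _ => ?_
  refine sum_loadOn_le_two_mul (isMaximalPacking_cluster hσ x r).nonneg S S' fun e he => ?_
  unfold clusterEdges at he
  obtain ⟨a, ha, he⟩ := Finset.mem_biUnion.1 he
  obtain ⟨b, hb, rfl⟩ := Finset.mem_image.1 he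
  rcases hcov a b (Finset.mem_filter.1 hb).1 with h | h
  · exact ⟨a, h, Sym2.mem_mk_left a b⟩
  · exact ⟨b, h, Sym2.mem_mk_right a b⟩

end Step

end Net

/-! ### The whole run: potential, number of superperiods and weight of the cover. -/

namespace Net

variable {U : Type} [DecidableEq U] {N : Net U} {V : Finset U} {A : ProcessParams}

theorem IsGraphOn.stateOk_run (h : N.IsGraphOn V) (hm : 1 ≤ A.m) (hK : 1 ≤ A.K) (t : ℕ) (v : U) :
    StateOk A (N.run A t v) := by
  induction t generalizing v with
  | zero =>
    have hw := h.wt_nonneg v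
    have hm0 : (0 : ℝ) < A.m := by exact_mod_cast hm
    refine ⟨hw, le_rfl, fun _ _ => le_rfl, ?_⟩
    have : ∀ r ∈ Finset.Icc 1 A.m, offer A (N.run A 0 v) r = N.wt v / (4 * A.m) :=
      fun r _ => if_pos trivial
    rw [Finset.sum_congr rfl this, Finset.sum_const, Nat.card_Icc, nsmul_eq_mul]
    simp only [Nat.add_sub_cancel, run]
    rw [show (A.m : ℝ) * (N.wt v / (4 * A.m)) = N.wt v / 4 by field_simp]
    linarith
  | succ t ih => exact stateOk_step ih hm hK t v

/-- The sum of the logarithms of the priorities that the clusters of an edge have at its ends. -/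
noncomputable def edgePotential (N : Net U) (A : ProcessParams) (a b : U) (r t : ℕ) : ℝ :=
  ∑ x ∈ N.ball a r ∪ N.ball b r,
    (Real.log ((N.run A t a).prio r x) + Real.log ((N.run A t b).prio r x))

theorem run_ref_add {τ j : ℕ} (hτ : period A.m ∣ τ) (hj : j < period A.m) (v : U) :
    (N.run A (τ + j) v).ref = (N.run A τ v).rem := by
  induction j with
  | zero =>
    cases τ with
    | zero => rfl
    | succ τ => exact if_pos hτ
  | succ j ih =>
    rw [← ih (by omega)]
    refine if_neg fun hd => ?_
    have := (Nat.dvd_add_right hτ).1 (show period A.m ∣ τ + (j + 1) from hd)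
    exact absurd (Nat.le_of_dvd (by omega) this) (by omega)

theorem IsGraphOn.run_awake_add (h : N.IsGraphOn V) {τ j r : ℕ} (hτ : period r ∣ τ)
    (hj : j < period r) (v : U) :
    (N.run A (τ + j) v).awake r ↔ (N.run A τ v).ref / 2 ≤ (N.run A τ v).rem := by
  induction j with
  | zero =>
    cases τ with
    | zero => exact ⟨fun _ => half_le_self (h.wt_nonneg v), fun _ => trivial⟩
    | succ τ => simp only [run, step, hτ, if_true]
  | succ j ih =>
    rw [← ih (by omega)]
    have : ¬ period r ∣ τ + j + 1 := fun hd => by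
      have := (Nat.dvd_add_right hτ).1 (show period r ∣ τ + (j + 1) from hd)
      exact absurd (Nat.le_of_dvd (by omega) this) (by omega)
    change (N.step A (N.run A (τ + j)) (τ + j) v).awake r ↔ _
    simp only [step, this, if_false]

section Run

variable (h : N.IsGraphOn V) (hm : 1 ≤ A.m) (hK : 1 ≤ A.K)

include h hm hK

theorem run_rem_antitone (v : U) : Antitone fun t => (N.run A t v).rem :=
  antitone_nat_of_succ_le fun t => nextRem_le (h.stateOk_run hm hK t) t v

theorem run_prio_monotone (v : U) (r : ℕ) (x : U) : Monotone fun t => (N.run A t v).prio r x :=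
  monotone_nat_of_le_succ fun t => prio_le_step (h.stateOk_run hm hK t) hK t r v x

/-- Telescopes `log_totalPrio_step_le` from time `0`, when all priorities are `1` and their sum is
the size of the ball. -/
theorem log_totalPrio_run_le {t r : ℕ} (hr : r ∈ Finset.Icc 1 A.m) {v : U}
    (hpos : 0 < (N.run A t v).rem) :
    Real.log (N.totalPrio (N.run A t v) v r) ≤ Real.log (N.ball v (r + 1)).card +
      4 * A.m * (A.K - 1) * (Real.log (N.wt v) - Real.log (N.run A t v).rem) := by
  induction t with
  | zero => simp [run, totalPrio]
  | succ t ih =>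
    have h1 := ih (hpos.trans_le (run_rem_antitone h hm hK v (Nat.le_succ t)))
    have h2 := log_totalPrio_step_le (h.stateOk_run hm hK t) hm hK hr (t := t) (v := v) hpos
    change Real.log (N.totalPrio (N.step A (N.run A t) t v) v r) ≤ _ + 4 * A.m * (A.K - 1) *
      (Real.log (N.wt v) - Real.log (N.nextRem A (N.run A t) t v))
    linarith

theorem log_prio_mono (v : U) (r : ℕ) (x : U) {s t : ℕ} (hst : s ≤ t) :
    Real.log ((N.run A s v).prio r x) ≤ Real.log ((N.run A t v).prio r x) :=
  Real.log_le_log (zero_lt_one.trans_le ((h.stateOk_run hm hK s v).one_le_prio r x))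
    (run_prio_monotone h hm hK v r x hst)

theorem edgePotential_mono (a b : U) (r : ℕ) : Monotone (N.edgePotential A a b r) :=
  fun _ _ hst => Finset.sum_le_sum fun x _ =>
    add_le_add (log_prio_mono h hm hK a r x hst) (log_prio_mono h hm hK b r x hst)

/-- Both ends stay awake for the whole period, and maximality of each cluster's packing forces a
raise at one of them. -/
theorem edgePotential_add_period {a b : U} (hb : b ∈ N.nb a) {r τ : ℕ}
    (hr : N.scale A a b = r) (hτ : period r ∣ τ)
    (ha : (N.run A τ a).ref / 2 ≤ (N.run A τ a).rem)
    (hb' : (N.run A τ b).ref / 2 ≤ (N.run A τ b).rem) :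
    N.edgePotential A a b r τ + N.edgeBallCard a b r * Real.log A.K ≤
      N.edgePotential A a b r (τ + period r) := by
  -- The raise happens in the last step of the period, from `τ + j` to `τ + j + 1`; before it,
  -- monotonicity is enough.
  obtain ⟨j, hj⟩ : ∃ j, period r = j + 1 := ⟨_, (Nat.sub_add_cancel (period_pos r)).symm⟩
  refine (add_le_add_left (edgePotential_mono h hm hK a b r (Nat.le_add_right τ j)) _).trans ?_
  have hd : period r ∣ τ + j + 1 := by
    rw [add_assoc, ← hj]; exact (Nat.dvd_add_right hτ).2 dvd_rfl
  rw [hj, ← add_assoc, edgePotential, edgePotential, edgeBallCard, ← nsmul_eq_mul,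
    ← Finset.sum_const, ← Finset.sum_add_distrib]
  refine Finset.sum_le_sum fun x hx => ?_
  have hA := log_prio_mono h hm hK a r x (Nat.le_succ (τ + j))
  have hB := log_prio_mono h hm hK b r x (Nat.le_succ (τ + j))
  have hlog : ∀ v, (N.step A (N.run A (τ + j)) (τ + j) v).prio r x =
      A.K * (N.run A (τ + j) v).prio r x → Real.log ((N.run A (τ + j + 1) v).prio r x) =
      Real.log A.K + Real.log ((N.run A (τ + j) v).prio r x) := by
    intro v hv
    rw [← Real.log_mul (by linarith)
      (zero_lt_one.trans_le ((h.stateOk_run hm hK _ v).one_le_prio r x)).ne', ← hv]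
    rfl
  rcases prio_step_of_awake (h.stateOk_run hm hK (τ + j)) h hd hb hr
    ((h.run_awake_add hτ (by omega) a).2 ha) ((h.run_awake_add hτ (by omega) b).2 hb') hx with h1 | h1
  · linarith [hlog a h1]
  · linarith [hlog b h1]

/-- Between two restarts, either all clusters of an edge make progress in all their periods, or
one of the ends of the edge loses half of its remaining weight. -/
theorem edgePotential_add_superperiod {a b : U} (hb : b ∈ N.nb a) {r τ q : ℕ}
    (hr : N.scale A a b = r) (hτ : period A.m ∣ τ) (hq : period A.m = q * period r) :
    N.edgePotential A a b r τ + q * (N.edgeBallCard a b r * Real.log A.K) ≤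
        N.edgePotential A a b r (τ + period A.m) ∨
      (N.run A (τ + period A.m) a).rem ≤ (N.run A τ a).rem / 2 ∨
      (N.run A (τ + period A.m) b).rem ≤ (N.run A τ b).rem / 2 := by
  have hlt : ∀ i < q, i * period r < period A.m := fun i hi => by
    rw [hq]; exact Nat.mul_lt_mul_of_pos_right hi (period_pos r)
  have hdvd : ∀ i, period r ∣ τ + i * period r := fun i =>
    dvd_add ((Dvd.intro_left q hq.symm).trans hτ) (Dvd.intro_left i rfl)
  -- The reference weight is the remaining weight at the restart `τ`, so a failed test is a halving
  -- since `τ`.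
  have hasleep : ∀ v, ∀ i < q, ¬ (N.run A (τ + i * period r) v).ref / 2 ≤
      (N.run A (τ + i * period r) v).rem →
      (N.run A (τ + period A.m) v).rem ≤ (N.run A τ v).rem / 2 := by
    intro v i hi hv
    rw [run_ref_add hτ (hlt i hi), not_le] at hv
    exact (run_rem_antitone h hm hK v (Nat.add_le_add_left (hlt i hi).le τ)).trans hv.le
  by_cases hA : ∀ i < q, (N.run A (τ + i * period r) a).ref / 2 ≤
      (N.run A (τ + i * period r) a).rem
  · by_cases hB : ∀ i < q, (N.run A (τ + i * period r) b).ref / 2 ≤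
        (N.run A (τ + i * period r) b).rem
    · left
      have : ∀ i ≤ q, N.edgePotential A a b r τ + i * (N.edgeBallCard a b r * Real.log A.K) ≤
          N.edgePotential A a b r (τ + i * period r) := by
        intro i hi
        induction i with
        | zero => simp
        | succ i ih =>
          have h1 := edgePotential_add_period h hm hK hb hr (hdvd i) (hA i hi) (hB i hi)
          rw [add_assoc τ, ← Nat.succ_mul] at h1
          push_cast
          linarith [ih (by omega)]
      rw [hq]
      exact this q le_rfl
    · push Not at hB
      obtain ⟨i, hi, h1⟩ := hB
      exact Or.inr (Or.inr (hasleep b i hi (not_le.2 h1)))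
  · push Not at hA
    obtain ⟨i, hi, h1⟩ := hA
    exact Or.inr (Or.inl (hasleep a i hi (not_le.2 h1)))

/-- Each superperiod is charged to one outcome: `g` counts full gains of potential, `i` and `j`
count halvings at the two ends. -/
theorem exists_superperiod_count {a b : U} (hb : b ∈ N.nb a) {r q : ℕ}
    (hr : N.scale A a b = r) (hq : period A.m = q * period r) (s : ℕ) :
    ∃ g i j : ℕ, s ≤ g + i + j ∧
      g * (q * (N.edgeBallCard a b r * Real.log A.K)) ≤
        N.edgePotential A a b r (s * period A.m) ∧
      (N.run A (s * period A.m) a).rem * 2 ^ i ≤ N.wt a ∧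
      (N.run A (s * period A.m) b).rem * 2 ^ j ≤ N.wt b := by
  induction s with
  | zero => exact ⟨0, 0, 0, le_rfl, by simp [edgePotential, run], by simp [run], by simp [run]⟩
  | succ s ih =>
    obtain ⟨g, i, j, hs, hg, hi, hj⟩ := ih
    have hmono := edgePotential_mono h hm hK a b r
      (Nat.le_add_right (s * period A.m) (period A.m))
    have ha := run_rem_antitone h hm hK a (Nat.le_add_right (s * period A.m) (period A.m))
    have hb' := run_rem_antitone h hm hK b (Nat.le_add_right (s * period A.m) (period A.m))
    have hi' := (mul_le_mul_of_nonneg_right ha (by positivity : (0 : ℝ) ≤ 2 ^ i)).trans hi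
    have hj' := (mul_le_mul_of_nonneg_right hb' (by positivity : (0 : ℝ) ≤ 2 ^ j)).trans hj
    rw [Nat.succ_mul]
    rcases edgePotential_add_superperiod h hm hK hb hr (Dvd.intro_left s rfl) hq with h1 | h1 | h1
    · exact ⟨g + 1, i, j, by omega, by push_cast; linarith, hi', hj'⟩
    · refine ⟨g, i + 1, j, by omega, hg.trans hmono, ?_, hj'⟩
      rw [pow_succ]
      nlinarith [mul_le_mul_of_nonneg_right h1 (by positivity : (0 : ℝ) ≤ 2 ^ i)]
    · refine ⟨g, i, j + 1, by omega, hg.trans hmono, hi', ?_⟩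
      rw [pow_succ]
      nlinarith [mul_le_mul_of_nonneg_right h1 (by positivity : (0 : ℝ) ≤ 2 ^ j)]

/-- The priorities of the clusters of an edge at one of its ends are bounded on average. -/
theorem sum_log_prio_le {a b : U} (hb : b ∈ N.nb a) {r t : ℕ} (hr : r ∈ Finset.Icc 1 A.m)
    {δ : ℝ} (hδ : 0 < δ) (ht : δ * N.wt a < (N.run A t a).rem) :
    ∑ x ∈ N.ball a r ∪ N.ball b r, Real.log ((N.run A t a).prio r x) ≤
      N.edgeBallCard a b r * (Real.log (N.edgeBallCard a b (r + 1) / N.edgeBallCard a b r) +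
        4 * A.m * (A.K - 1) * -Real.log δ) := by
  have hok := h.stateOk_run hm hK t a
  have hrem : 0 < (N.run A t a).rem := (mul_nonneg hδ.le (h.wt_nonneg a)).trans_lt ht
  have hw : 0 < N.wt a := hrem.trans_le (run_rem_antitone h hm hK a (Nat.zero_le t))
  have hc : (0 : ℝ) < N.edgeBallCard a b r := by exact_mod_cast edgeBallCard_pos a b r
  have hc' : (0 : ℝ) < N.edgeBallCard a b (r + 1) := by exact_mod_cast edgeBallCard_pos a b (r + 1)
  have hP := hok.totalPrio_pos (N := N) a r
  set P := N.totalPrio (N.run A t a) a r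
  set c : ℝ := (N.edgeBallCard a b r : ℝ)
  have hsub : N.ball a r ∪ N.ball b r ⊆ N.ball a (r + 1) := by
    refine Finset.union_subset (ball_mono a (Nat.le_succ r)) fun x hx => ?_
    exact ball_mono a (by omega)
      (mem_ball_trans (mem_ball_of_mem_nb (self_mem_ball a 0) hb) hx)
  have h1 : ∑ x ∈ N.ball a r ∪ N.ball b r, Real.log ((N.run A t a).prio r x) ≤
      c * (Real.log P - Real.log c) := by
    -- Jensen's inequality by hand: the tangent of `log` at the average value `P / c` bounds every
    -- term.
    have hterm : ∀ x ∈ N.ball a r ∪ N.ball b r, Real.log ((N.run A t a).prio r x) ≤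
        (N.run A t a).prio r x * (c / P) + (Real.log P - Real.log c - 1) := by
      intro x _
      have hp := zero_lt_one.trans_le (hok.one_le_prio r x)
      have := Real.log_le_sub_one_of_pos (x := (N.run A t a).prio r x * (c / P)) (by positivity)
      rw [Real.log_mul hp.ne' (by positivity), Real.log_div hc.ne' hP.ne'] at this
      linarith
    refine (Finset.sum_le_sum hterm).trans ?_
    rw [Finset.sum_add_distrib, ← Finset.sum_mul, Finset.sum_const, nsmul_eq_mul]
    change _ + c * _ ≤ _
    have h2 : ∑ x ∈ N.ball a r ∪ N.ball b r, (N.run A t a).prio r x ≤ P :=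
      Finset.sum_le_sum_of_subset_of_nonneg hsub fun x _ _ =>
        zero_le_one.trans (hok.one_le_prio r x)
    have h3 : (∑ x ∈ N.ball a r ∪ N.ball b r, (N.run A t a).prio r x) * (c / P) ≤ P * (c / P) := by
      gcongr
    rw [mul_div_cancel₀ _ hP.ne'] at h3
    linarith
  refine h1.trans ?_
  have h2 := log_totalPrio_run_le h hm hK hr hrem
  have h3 : Real.log (N.ball a (r + 1)).card ≤ Real.log (N.edgeBallCard a b (r + 1)) :=
    Real.log_le_log (by exact_mod_cast Finset.card_pos.2 ⟨a, self_mem_ball a _⟩)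
      (by exact_mod_cast Finset.card_le_card Finset.subset_union_left)
  have h4 : Real.log (N.wt a) - Real.log (N.run A t a).rem ≤ -Real.log δ := by
    have := Real.log_le_log (by positivity) ht.le
    rw [Real.log_mul hδ.ne' hw.ne'] at this
    linarith
  have h5 : 4 * A.m * (A.K - 1) * (Real.log (N.wt a) - Real.log (N.run A t a).rem) ≤
      4 * A.m * (A.K - 1) * -Real.log δ := by
    have : 0 ≤ A.K - 1 := by linarith
    gcongr
  rw [Real.log_div hc'.ne' hc.ne']
  gcongr
  linarith

/-- If an edge is not covered after `s` superperiods, then `s` is small. -/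
theorem superperiods_le {a b : U} (hb : b ∈ N.nb a) (hV : V.card ≤ A.n) {δ : ℝ} (hδ : 0 < δ)
    (hδ1 : δ ≤ 1) {s : ℕ} (ha : δ * N.wt a < (N.run A (s * period A.m) a).rem)
    (hb' : δ * N.wt b < (N.run A (s * period A.m) b).rem) :
    ∃ r ∈ Finset.Icc 1 A.m, (s + 2 * Real.log δ / Real.log 2) *
      (period A.m / period r) * Real.log A.K ≤
      2 * (Real.log A.n / (r * ∑ i ∈ Finset.Icc 1 A.m, (i : ℝ)⁻¹) +
        4 * A.m * (A.K - 1) * -Real.log δ) := by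
  obtain ⟨hr, hgrow⟩ := h.scale_spec hV hm hb
  generalize hrs : N.scale A a b = r at hr hgrow
  obtain ⟨q, hq⟩ := period_dvd (Finset.mem_Icc.1 hr).2
  rw [mul_comm] at hq
  obtain ⟨g, i, j, hs, hg, hi, hj⟩ := exists_superperiod_count h hm hK hb hrs hq s
  refine ⟨r, hr, ?_⟩
  have hr0 : (0 : ℝ) < r := by exact_mod_cast (Finset.mem_Icc.1 hr).1
  have hp0 : (0 : ℝ) < period r := by exact_mod_cast period_pos r
  have hH : 0 < ∑ i ∈ Finset.Icc 1 A.m, (i : ℝ)⁻¹ := Finset.sum_pos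
    (fun i hi => by have := (Finset.mem_Icc.1 hi).1; positivity) ⟨1, by simpa using hm⟩
  have hqr : (period A.m : ℝ) / period r = q := by
    rw [hq]; push_cast; exact mul_div_cancel_right₀ _ hp0.ne'
  have hl2 := Real.log_pos one_lt_two
  -- A node that still has more than a `δ` fraction was halved at most `log₂ (1 / δ)` times.
  have hhalf : ∀ v (i : ℕ), δ * N.wt v < (N.run A (s * period A.m) v).rem →
      (N.run A (s * period A.m) v).rem * 2 ^ i ≤ N.wt v → (i : ℝ) ≤ -Real.log δ / Real.log 2 := by
    intro v i h1 h2
    have hw : 0 < N.wt v := ((mul_nonneg hδ.le (h.wt_nonneg v)).trans_lt h1).trans_le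
      (run_rem_antitone h hm hK v (Nat.zero_le _))
    have h3 : δ * 2 ^ i ≤ 1 := by
      have : δ * N.wt v * 2 ^ i ≤ N.wt v :=
        (mul_le_mul_of_nonneg_right h1.le (by positivity)).trans h2
      nlinarith
    have h4 := Real.log_le_log (by positivity) h3
    rw [Real.log_mul hδ.ne' (by positivity), Real.log_pow, Real.log_one] at h4
    rw [le_div_iff₀ hl2]
    linarith
  have hi' := hhalf a i ha hi
  have hj' := hhalf b j hb' hj
  have hg' : (s : ℝ) + 2 * Real.log δ / Real.log 2 ≤ g := by
    have : (s : ℝ) ≤ g + i + j := by exact_mod_cast hs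
    have e : 2 * Real.log δ / Real.log 2 = -(2 * (-Real.log δ / Real.log 2)) := by ring
    linarith
  have hc : (0 : ℝ) < N.edgeBallCard a b r := by exact_mod_cast edgeBallCard_pos a b r
  have hup : N.edgePotential A a b r (s * period A.m) ≤ N.edgeBallCard a b r *
      (2 * (Real.log (N.edgeBallCard a b (r + 1) / N.edgeBallCard a b r) +
        4 * A.m * (A.K - 1) * -Real.log δ)) := by
    rw [edgePotential, Finset.sum_add_distrib]
    have h1 := sum_log_prio_le h hm hK hb hr hδ ha
    have h2 := sum_log_prio_le h hm hK (h.symm a b hb) hr hδ hb'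
    rw [Finset.union_comm, ← edgeBallCard_comm a b r, ← edgeBallCard_comm a b (r + 1)] at h2
    linarith
  have h1 : g * q * Real.log A.K ≤
      2 * (Real.log (N.edgeBallCard a b (r + 1) / N.edgeBallCard a b r) +
        4 * A.m * (A.K - 1) * -Real.log δ) := by
    refine le_of_mul_le_mul_left ?_ hc
    linarith
  have h2 : Real.log (N.edgeBallCard a b (r + 1) / N.edgeBallCard a b r) ≤
      Real.log A.n / (r * ∑ i ∈ Finset.Icc 1 A.m, (i : ℝ)⁻¹) := by
    rw [le_div_iff₀ (by positivity)]
    linarith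
  have h3 : 0 ≤ Real.log A.K := Real.log_nonneg hK
  rw [hqr]
  calc _ ≤ g * q * Real.log A.K := by gcongr
    _ ≤ _ := by linarith

/-- The nodes that have used up most of their weight are cheap compared to any vertex cover. -/
theorem sum_wt_sub_rem_le {S S' : Finset U} (hS : S ⊆ V) (hS' : S' ⊆ V)
    (hcov : ∀ a, ∀ b ∈ N.nb a, a ∈ S' ∨ b ∈ S') (t : ℕ) :
    ∑ v ∈ S, (N.wt v - (N.run A t v).rem) ≤ 2 * ∑ v ∈ S', (N.wt v - (N.run A t v).rem) := by
  induction t with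
  | zero => simp [run]
  | succ t ih =>
    have h1 := sum_rem_sub_nextRem_le (h.stateOk_run hm hK t) h t hS hS' hcov
    have h2 : ∀ S : Finset U, ∑ v ∈ S, (N.wt v - (N.run A (t + 1) v).rem) =
        ∑ v ∈ S, (N.wt v - (N.run A t v).rem) +
        ∑ v ∈ S, ((N.run A t v).rem - N.nextRem A (N.run A t) t v) := fun S => by
      rw [← Finset.sum_add_distrib]
      exact Finset.sum_congr rfl fun v _ => by
        change _ - N.nextRem A (N.run A t) t v = _
        ring
    rw [h2, h2]
    linarith

theorem sum_wt_le_of_tight {S S' : Finset U} (hS : S ⊆ V) (hS' : S' ⊆ V)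
    (hcov : ∀ a, ∀ b ∈ N.nb a, a ∈ S' ∨ b ∈ S') {t : ℕ} {δ : ℝ}
    (htight : ∀ v ∈ S, (N.run A t v).rem ≤ δ * N.wt v) :
    (1 - δ) * ∑ v ∈ S, N.wt v ≤ 2 * ∑ v ∈ S', N.wt v := by
  rw [Finset.mul_sum]
  calc ∑ v ∈ S, (1 - δ) * N.wt v ≤ ∑ v ∈ S, (N.wt v - (N.run A t v).rem) :=
        Finset.sum_le_sum fun v hv => by linarith [htight v hv]
    _ ≤ 2 * ∑ v ∈ S', (N.wt v - (N.run A t v).rem) := sum_wt_sub_rem_le h hm hK hS hS' hcov t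
    _ ≤ 2 * ∑ v ∈ S', N.wt v := by
        gcongr with v
        exact sub_le_self _ (h.stateOk_run hm hK t v).rem_nonneg

end Run

end Net

/-- `Net.ball` grows at its boundary, but records reach `v` through its neighbours; this peels off
the first edge of a path instead of the last. -/
theorem Net.mem_ball_succ_of_nb {U : Type} [DecidableEq U] {N : Net U} {v x : U} {k : ℕ}
    (hx : x ∈ N.ball v (k + 1)) : x = v ∨ ∃ u ∈ N.nb v, x ∈ N.ball u k := by
  induction k generalizing x with
  | zero =>
    simp only [Net.ball, Finset.mem_union, Finset.mem_biUnion, Finset.mem_singleton,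
      exists_eq_left] at hx
    exact hx.imp_right fun h => ⟨x, h, Net.self_mem_ball x 0⟩
  | succ k ih =>
    rw [Net.ball, Finset.mem_union, Finset.mem_biUnion] at hx
    rcases hx with hx | ⟨a, ha, hx⟩
    · exact (ih hx).imp_right fun ⟨u, hu, h⟩ => ⟨u, hu, Net.ball_mono u (Nat.le_succ k) h⟩
    · rcases ih ha with rfl | ⟨u, hu, h⟩
      · exact Or.inr ⟨x, hx, Net.self_mem_ball x _⟩
      · exact Or.inr ⟨u, hu, Net.mem_ball_of_mem_nb h hx⟩

/-! ### Gossip -/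

/-- What a node announces about itself: identifier, weight and identifiers of its neighbours. -/
abbrev NodeRecord : Type := unitInterval × ℝ≥0 × Finset unitInterval

/-- The state of a node that collects the records of other nodes. -/
structure GossipState where
  size : ℕ
  ident : unitInterval
  weight : ℝ≥0
  known : Set NodeRecord

open Classical in
/-- The data recorded in `R` for the identifier `a`. -/
noncomputable def lookup (R : Set NodeRecord) (a : unitInterval) : ℝ≥0 × Finset unitInterval :=
  if h : ∃ p, (a, p) ∈ R then h.choose else (0, ∅)

/-- The network described by a set of records. -/
noncomputable def netOf (R : Set NodeRecord) : Net unitInterval where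
  nb a := (lookup R a).2
  wt a := (lookup R a).1

/-- The algorithm in which every node, with its seed as identifier, collects the records of all
nodes near it and evaluates `f` on the network that it knows. -/
noncomputable def gossip (f : ℕ → Net unitInterval → unitInterval → Bool) :
    LocalAlgorithm ℝ≥0 Bool where
  State := GossipState
  Msg := GossipState
  init n _ x s := ⟨n, s, x, ∅⟩
  send q _ := q
  recv q _ msg := ⟨q.size, q.ident, q.weight,
    q.known ∪ {(q.ident, q.weight, Finset.univ.image fun i => (msg i).ident)} ∪
      ⋃ i, (msg i).known⟩
  out q := f q.size (netOf q.known) q.ident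

theorem lookup_eq {R : Set NodeRecord} (hR : ∀ a p q, (a, p) ∈ R → (a, q) ∈ R → p = q)
    {a : unitInterval} {p : ℝ≥0 × Finset unitInterval} (h : (a, p) ∈ R) : lookup R a = p := by
  have hex : ∃ p, (a, p) ∈ R := ⟨p, h⟩
  rw [lookup, dif_pos hex]
  exact hR a _ _ hex.choose_spec h

section Gossip

variable {V : Type} [Fintype V] {G : SimpleGraph V} (P : PortNumbering G) (w : V → ℝ≥0)
  (s : V → unitInterval) (f : ℕ → Net unitInterval → unitInterval → Bool)

/-- The record of the node `v`. -/
noncomputable def nodeRecord (v : V) : NodeRecord :=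
  (s v, w v, Finset.univ.image fun i => s (P.nbr v i))

/-- The network with the seeds as identifiers. -/
noncomputable def seedNet : Net unitInterval := netOf (Set.range (nodeRecord P w s))

theorem gossip_state_fields (t : ℕ) (v : V) :
    ((gossip f).stateAfter P w s t v : GossipState).size = Fintype.card V ∧
    ((gossip f).stateAfter P w s t v : GossipState).ident = s v ∧
    ((gossip f).stateAfter P w s t v : GossipState).weight = w v := by
  induction t with
  | zero => exact ⟨rfl, rfl, rfl⟩
  | succ t ih => exact ih

theorem gossip_known_succ (t : ℕ) (v : V) :
    ((gossip f).stateAfter P w s (t + 1) v : GossipState).known =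
      ((gossip f).stateAfter P w s t v : GossipState).known ∪ {nodeRecord P w s v} ∪
        ⋃ i, ((gossip f).stateAfter P w s t (P.nbr v i) : GossipState).known := by
  obtain ⟨-, h2, h3⟩ := gossip_state_fields P w s f t v
  have h4 := fun i => (gossip_state_fields P w s f t (P.nbr v i)).2.1
  unfold nodeRecord
  rw [← h2, ← h3]
  simp only [← h4]
  rfl

theorem gossip_known_subset (t : ℕ) (v : V) :
    ((gossip f).stateAfter P w s t v : GossipState).known ⊆ Set.range (nodeRecord P w s) := by
  induction t generalizing v with
  | zero => exact Set.empty_subset _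
  | succ t ih =>
    rw [gossip_known_succ]
    exact Set.union_subset (Set.union_subset (ih v) (Set.singleton_subset_iff.2 ⟨v, rfl⟩))
      (Set.iUnion_subset fun i => ih _)

variable {s} (hs : Function.Injective s)

include hs

omit [Fintype V] in
theorem nodeRecord_functional (a : unitInterval) (p q : ℝ≥0 × Finset unitInterval)
    (hp : (a, p) ∈ Set.range (nodeRecord P w s)) (hq : (a, q) ∈ Set.range (nodeRecord P w s)) :
    p = q := by
  obtain ⟨u, hu⟩ := hp
  obtain ⟨v, hv⟩ := hq
  obtain rfl : u = v := hs ((congrArg Prod.fst hu).trans (congrArg Prod.fst hv).symm)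
  exact congrArg Prod.snd (hu.symm.trans hv)

omit [Fintype V] in
theorem seedNet_nb (v : V) :
    (seedNet P w s).nb (s v) = Finset.univ.image fun i => s (P.nbr v i) :=
  congrArg Prod.snd (lookup_eq (nodeRecord_functional P w hs) ⟨v, rfl⟩)

omit [Fintype V] in
theorem seedNet_wt (v : V) : (seedNet P w s).wt (s v) = w v :=
  congrArg (fun p : ℝ≥0 × Finset unitInterval => (p.1 : ℝ))
    (lookup_eq (nodeRecord_functional P w hs) ⟨v, rfl⟩)

theorem mem_seedNet_nb {a b : unitInterval} :
    b ∈ (seedNet P w s).nb a ↔ ∃ u v, s u = a ∧ s v = b ∧ G.Adj u v := by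
  constructor
  · intro hb
    by_cases ha : ∃ u, s u = a
    · obtain ⟨u, rfl⟩ := ha
      rw [seedNet_nb P w hs] at hb
      obtain ⟨i, -, rfl⟩ := Finset.mem_image.1 hb
      exact ⟨u, _, rfl, rfl, (P.port u i).2⟩
    -- An identifier that no node carries gets the default record, hence no neighbours.
    · have : lookup (Set.range (nodeRecord P w s)) a = (0, ∅) :=
        dif_neg fun ⟨p, u, hu⟩ => ha ⟨u, congrArg Prod.fst hu⟩
      simp [seedNet, netOf, this] at hb
  · rintro ⟨u, v, rfl, rfl, huv⟩
    rw [seedNet_nb P w hs]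
    refine Finset.mem_image.2 ⟨(P.port u).symm ⟨v, huv⟩, Finset.mem_univ _, ?_⟩
    simp [PortNumbering.nbr]

theorem seedNet_isGraphOn : (seedNet P w s).IsGraphOn (Finset.univ.image s) where
  symm a b hb := by
    rw [mem_seedNet_nb P w hs] at hb ⊢
    obtain ⟨u, v, hu, hv, huv⟩ := hb
    exact ⟨v, u, hv, hu, huv.symm⟩
  nb_subset a b hb := by
    obtain ⟨u, v, -, rfl, -⟩ := (mem_seedNet_nb P w hs).1 hb
    exact Finset.mem_image_of_mem s (Finset.mem_univ v)
  wt_nonneg a := NNReal.coe_nonneg _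

theorem nodeRecord_mem_known {t : ℕ} {v : V} {x : unitInterval}
    (hx : x ∈ (seedNet P w s).ball (s v) t) :
    ∃ u, s u = x ∧ nodeRecord P w s u ∈
      ((gossip f).stateAfter P w s (t + 1) v : GossipState).known := by
  induction t generalizing v with
  | zero =>
    refine ⟨v, (Finset.mem_singleton.1 hx).symm, ?_⟩
    rw [gossip_known_succ]
    exact Or.inl (Or.inr rfl)
  | succ t ih =>
    rcases Net.mem_ball_succ_of_nb hx with rfl | ⟨a, ha, hx⟩
    · refine ⟨v, rfl, ?_⟩
      rw [gossip_known_succ]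
      exact Or.inl (Or.inr rfl)
    · rw [seedNet_nb P w hs] at ha
      obtain ⟨i, -, rfl⟩ := Finset.mem_image.1 ha
      obtain ⟨u, hu, h⟩ := ih hx
      refine ⟨u, hu, ?_⟩
      rw [gossip_known_succ]
      exact Or.inr (Set.mem_iUnion.2 ⟨i, h⟩)

/-- The extra round is needed because a node can form its own record only after hearing its
neighbours' identifiers. -/
theorem agree_gossip (t : ℕ) (v : V) :
    (seedNet P w s).Agree (netOf ((gossip f).stateAfter P w s (t + 1) v : GossipState).known)
      (s v) t := by
  intro x hx
  obtain ⟨u, rfl, hu⟩ := nodeRecord_mem_known P w f hs hx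
  have h1 := lookup_eq (nodeRecord_functional P w hs) (Set.mem_range_self u)
  have h2 := lookup_eq (fun a p q hp hq => nodeRecord_functional P w hs a p q
    (gossip_known_subset P w s f _ v hp) (gossip_known_subset P w s f _ v hq)) hu
  exact ⟨congrArg Prod.snd (h1.trans h2.symm),
    congrArg (fun p : ℝ≥0 × Finset unitInterval => (p.1 : ℝ)) (h1.trans h2.symm)⟩

end Gossip

/-! ### The vertex cover algorithm -/

open Classical in
/-- A node joins the cover if the packing uses up its weight up to a fraction of `δ`. -/
noncomputable def coverRule (A : ℕ → ProcessParams) (T : ℕ → ℕ) (δ : ℕ → ℝ) (n : ℕ)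
    (N : Net unitInterval) (a : unitInterval) : Bool :=
  decide ((N.run (A n) (T n) a).rem ≤ δ n * N.wt a)

/-- By locality each node decides as if it knew all of `seedNet`. An uncovered edge would contradict
`hS` through `Net.superperiods_le`; the weight bound is packing duality. -/
theorem isApproxMinWeightVertexCover_gossip {V : Type} [Fintype V] {G : SimpleGraph V}
    (P : PortNumbering G) (w : V → ℝ≥0) {s : V → unitInterval} (hs : Function.Injective s)
    (A : ℕ → ProcessParams) (S : ℕ → ℕ) (δ : ℕ → ℝ) {n : ℕ} (hn : Fintype.card V = n)
    (hAn : (A n).n = n) (hm : 1 ≤ (A n).m) (hK : 1 ≤ (A n).K) (hδ : 0 < δ n) (hδ1 : δ n < 1)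
    (hS : ∀ r ∈ Finset.Icc 1 (A n).m,
      2 * (Real.log n / (r * ∑ i ∈ Finset.Icc 1 (A n).m, (i : ℝ)⁻¹) +
        4 * (A n).m * ((A n).K - 1) * -Real.log (δ n)) <
      (S n + 2 * Real.log (δ n) / Real.log 2) *
        (period (A n).m / period r) * Real.log (A n).K)
    {α : ℝ} (hα : 2 ≤ α * (1 - δ n)) :
    IsApproxMinWeightVertexCover G w α (Finset.univ.filter fun v =>
      (gossip (coverRule A (fun n => S n * period (A n).m) δ)).outputAfter P w s
        ((A n).m + 2 + S n * period (A n).m + 1) v = true) := by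
  classical
  subst hn
  set n := Fintype.card V
  set f := coverRule A (fun n => S n * period (A n).m) δ
  have hG := seedNet_isGraphOn P w hs
  have hcard : (Finset.univ.image s).card ≤ (A n).n := by
    rw [hAn]; exact Finset.card_image_le
  have hout : ∀ v, (gossip f).outputAfter P w s ((A n).m + 2 + S n * period (A n).m + 1) v = true ↔
      ((seedNet P w s).run (A n) (S n * period (A n).m) (s v)).rem ≤
        δ n * (seedNet P w s).wt (s v) := by
    intro v
    have hag := agree_gossip P w f hs ((A n).m + 2 + S n * period (A n).m) v
    have h1 := (Net.run_eq_of_agree (A := A n) (S n * period (A n).m)).1 _ hag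
    have h2 := (hag _ (Net.self_mem_ball _ _)).2
    obtain ⟨h3, h4, -⟩ := gossip_state_fields P w s f
      ((A n).m + 2 + S n * period (A n).m + 1) v
    rw [h1, h2, LocalAlgorithm.outputAfter]
    set q : GossipState := (gossip f).stateAfter P w s ((A n).m + 2 + S n * period (A n).m + 1) v
    change f q.size (netOf q.known) q.ident = true ↔ _
    rw [h3, h4]
    exact decide_eq_true_iff
  refine ⟨fun u v huv => ?_, fun S' hS' => ?_⟩
  · by_contra hcon
    simp only [Finset.coe_filter, Finset.mem_univ, true_and, Set.mem_ofPred_eq, hout, not_or,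
      not_le] at hcon
    obtain ⟨r, hr, hle⟩ := Net.superperiods_le hG hm hK
      ((mem_seedNet_nb P w hs).2 ⟨u, v, rfl, rfl, huv⟩) hcard hδ hδ1.le hcon.1 hcon.2
    rw [hAn] at hle
    exact absurd hle (not_le.2 (hS r hr))
  · have hsum : ∀ S : Finset V, ∑ a ∈ S.image s, (seedNet P w s).wt a = ((∑ v ∈ S, w v : ℝ≥0) : ℝ) := by
      intro S
      rw [Finset.sum_image hs.injOn, NNReal.coe_sum]
      exact Finset.sum_congr rfl fun v _ => seedNet_wt P w hs v
    have hcov : ∀ a, ∀ b ∈ (seedNet P w s).nb a, a ∈ S'.image s ∨ b ∈ S'.image s := by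
      intro a b hb
      obtain ⟨u, v, rfl, rfl, huv⟩ := (mem_seedNet_nb P w hs).1 hb
      exact (hS' huv).imp (Finset.mem_image_of_mem s) (Finset.mem_image_of_mem s)
    have h1 := Net.sum_wt_le_of_tight hG hm hK
      (Finset.image_subset_image (Finset.subset_univ (Finset.univ.filter fun v =>
        (gossip f).outputAfter P w s ((A n).m + 2 + S n * period (A n).m + 1) v = true)))
      (Finset.image_subset_image (Finset.subset_univ S')) hcov
      (t := S n * period (A n).m) (δ := δ n) (by
        intro a ha
        obtain ⟨v, hv, rfl⟩ := Finset.mem_image.1 ha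
        exact (hout v).1 (Finset.mem_filter.1 hv).2)
    rw [hsum, hsum] at h1
    have h0 : (0 : ℝ) ≤ ((∑ v ∈ S', w v : ℝ≥0) : ℝ) := NNReal.coe_nonneg _
    have hd : 0 < 1 - δ n := by linarith
    refine le_of_mul_le_mul_left (h1.trans ?_) hd
    nlinarith

/-! ### Seeds are distinct -/

/-- Two coordinates are independent and uniform without atoms, so by Fubini they coincide with
probability zero; there are finitely many pairs. -/
theorem seedMeasure_not_injective (V : Type) [Fintype V] :
    seedMeasure V {s | ¬ Function.Injective s} = 0 := by
  classical
  have hsub : {s : V → unitInterval | ¬ Function.Injective s} ⊆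
      ⋃ p ∈ {p : V × V | p.1 ≠ p.2}, {s | s p.1 = s p.2} := by
    intro s hs
    simp only [Set.mem_ofPred_eq, Function.Injective, not_forall] at hs
    obtain ⟨i, j, hij, hne⟩ := hs
    exact Set.mem_biUnion (x := (i, j)) hne hij
  refine MeasureTheory.measure_mono_null hsub ?_
  rw [MeasureTheory.measure_biUnion_null_iff (Set.to_countable _)]
  rintro ⟨i, j⟩ hij
  have : MeasureTheory.IsProbabilityMeasure (seedMeasure V) := by
    unfold seedMeasure; infer_instance
  have hind : ProbabilityTheory.IndepFun (fun s : V → unitInterval => s i) (fun s => s j)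
      (seedMeasure V) :=
    (ProbabilityTheory.iIndepFun_pi (X := fun _ => id) fun _ => aemeasurable_id).indepFun hij
  have hmap : ∀ i, (seedMeasure V).map (fun s => s i) = MeasureTheory.volume := fun i =>
    (MeasureTheory.measurePreserving_eval _ i).map_eq
  have hprod := hind.map_prod_eq_prod_map_map (measurable_pi_apply i).aemeasurable
    (measurable_pi_apply j).aemeasurable
  rw [hmap, hmap] at hprod
  have hdiag : MeasurableSet {p : unitInterval × unitInterval | p.1 = p.2} :=
    measurableSet_eq_fun measurable_fst measurable_snd
  change seedMeasure V ((fun s => (s i, s j)) ⁻¹' {p | p.1 = p.2}) = 0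
  rw [← MeasureTheory.Measure.map_apply (by fun_prop) hdiag, hprod,
    MeasureTheory.Measure.measure_prod_null hdiag]
  filter_upwards with x
  have : Prod.mk x ⁻¹' {p : unitInterval × unitInterval | p.1 = p.2} = {x} := by
    ext y; simp [eq_comm]
  rw [this]
  exact MeasureTheory.measure_singleton x

/-! ### Choice of the parameters -/

/-- The parameters used for networks with `n` nodes. -/
noncomputable def coverParams (n : ℕ) : ProcessParams where
  n := n
  -- A small power of `log n`: `log m` keeps the order of `log log n`, while terms of order `m ^ 3 *
  -- log (1 / δ)` stay negligible against `log n / (log log n) ^ 2`.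
  m := ⌈Real.log n ^ (1 / 8 : ℝ)⌉₊
  K := ⌈Real.log n ^ (1 / 8 : ℝ)⌉₊ + 1

/-- The number of superperiods after which the process stops. -/
noncomputable def superperiodCount (A : ProcessParams) (δ : ℝ) : ℕ :=
  -- The first term pays for halvings at both ends, the second for gains of potential; `16 = 2 * 8`
  -- combines the two ends with `period r ≤ 8 * r`.
  ⌊2 * -Real.log δ / Real.log 2 + 16 / (period A.m * Real.log A.K) *
    (Real.log A.n / (∑ i ∈ Finset.Icc 1 A.m, (i : ℝ)⁻¹) + 4 * A.m ^ 3 * -Real.log δ)⌋₊ + 1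

theorem log_add_one_le_sum_inv (m : ℕ) :
    Real.log (m + 1) ≤ ∑ i ∈ Finset.Icc 1 m, (i : ℝ)⁻¹ := by
  have := log_add_one_le_harmonic m
  rw [harmonic_eq_sum_Icc] at this
  push_cast at this
  exact_mod_cast this

theorem lt_superperiodCount {A : ProcessParams} (hm : 1 ≤ A.m) (hK : A.K = A.m + 1)
    {δ : ℝ} (hδ : 0 < δ) (hδ1 : δ < 1) {r : ℕ} (hr : r ∈ Finset.Icc 1 A.m) :
    2 * (Real.log A.n / (r * ∑ i ∈ Finset.Icc 1 A.m, (i : ℝ)⁻¹) +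
        4 * A.m * (A.K - 1) * -Real.log δ) <
      (superperiodCount A δ + 2 * Real.log δ / Real.log 2) *
        (period A.m / period r) * Real.log A.K := by
  have hm1 : (1 : ℝ) ≤ A.m := by exact_mod_cast hm
  obtain ⟨hr1, hrm⟩ := Finset.mem_Icc.1 hr
  have hr0 : (0 : ℝ) < r := by exact_mod_cast hr1
  have hrm' : (r : ℝ) ≤ A.m := by exact_mod_cast hrm
  have hlK : 0 < Real.log A.K := Real.log_pos (by rw [hK]; linarith)
  have hM : (0 : ℝ) < period A.m := by exact_mod_cast period_pos A.m
  have hp : (0 : ℝ) < period r := by exact_mod_cast period_pos r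
  have hp8 : (period r : ℝ) ≤ 8 * r := by exact_mod_cast period_le hr1
  have hD : 0 < -Real.log δ := neg_pos.2 (Real.log_neg hδ hδ1)
  have hH : 0 < ∑ i ∈ Finset.Icc 1 A.m, (i : ℝ)⁻¹ := Finset.sum_pos
    (fun i hi => by have := (Finset.mem_Icc.1 hi).1; positivity) ⟨1, by simpa using hm⟩
  have hln : 0 ≤ Real.log A.n := Real.log_natCast_nonneg _
  have hS := Nat.lt_floor_add_one (2 * -Real.log δ / Real.log 2 +
    16 / (period A.m * Real.log A.K) * (Real.log A.n / (∑ i ∈ Finset.Icc 1 A.m, (i : ℝ)⁻¹) +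
      4 * A.m ^ 3 * -Real.log δ))
  have hS' : 16 / (period A.m * Real.log A.K) *
      (Real.log A.n / (∑ i ∈ Finset.Icc 1 A.m, (i : ℝ)⁻¹) + 4 * A.m ^ 3 * -Real.log δ) <
      superperiodCount A δ + 2 * Real.log δ / Real.log 2 := by
    unfold superperiodCount
    push_cast
    rw [show 2 * Real.log δ / Real.log 2 = -(2 * -Real.log δ / Real.log 2) by ring]
    linarith
  generalize (superperiodCount A δ : ℝ) + 2 * Real.log δ / Real.log 2 = X at hS' ⊢
  generalize (∑ i ∈ Finset.Icc 1 A.m, (i : ℝ)⁻¹) = H at *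
  generalize -Real.log δ = D at *
  rw [hK, add_sub_cancel_right, ← hK]
  generalize Real.log A.K = k at *
  have h1 : (period A.m : ℝ) / (8 * r) ≤ period A.m / period r := by gcongr
  have h2 : 0 < 16 / (period A.m * k) * (Real.log A.n / H + 4 * A.m ^ 3 * D) := by positivity
  calc 2 * (Real.log A.n / (r * H) + 4 * A.m * A.m * D)
      = 2 / r * (Real.log A.n / H + 4 * (r * A.m ^ 2) * D) := by field_simp
    _ ≤ 2 / r * (Real.log A.n / H + 4 * (A.m * A.m ^ 2) * D) := by gcongr
    _ = 16 / (period A.m * k) * (Real.log A.n / H + 4 * A.m ^ 3 * D) *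
        (period A.m / (8 * r)) * k := by field_simp; ring
    _ < X * (period A.m / (8 * r)) * k := by gcongr
    _ ≤ X * (period A.m / period r) * k := by
        have : 0 < X := h2.trans hS'
        gcongr

/-- The running time, in terms of `l = log n`, `L = log (log n)` and `x = l ^ (1 / 8)`. -/
theorem rounds_le {A : ProcessParams} {l L x κ δ : ℝ} (hx1 : 1 ≤ x) (hxm : x ≤ A.m)
    (hmx : A.m ≤ 2 * x) (hK : A.K = A.m + 1) (hl : Real.log A.n = l) (hlx : l = x ^ 8)
    (hL : L = 8 * Real.log x) (hL1 : 1 ≤ L) (hκ : 1 ≤ κ) (hδ1 : δ < 1) (hδ : 0 < δ)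
    (hD : -Real.log δ ≤ κ * L) (hbig : 4448 * κ * L ^ 3 ≤ x ^ 5) :
    ((A.m + 2 + superperiodCount A δ * period A.m + 1 : ℕ) : ℝ) ≤ 1025 * (l / L ^ 2) := by
  have hm1 : (1 : ℝ) ≤ A.m := hx1.trans hxm
  have hmnat : 1 ≤ A.m := by exact_mod_cast hm1
  have hM : (0 : ℝ) < period A.m := by exact_mod_cast period_pos A.m
  have hM8 : (period A.m : ℝ) ≤ 8 * A.m := by exact_mod_cast period_le hmnat
  have hlK : L / 8 ≤ Real.log A.K := by
    rw [hL, hK, mul_div_cancel_left₀ _ (by norm_num)]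
    exact Real.log_le_log (by linarith) (by linarith)
  have hH : L / 8 ≤ ∑ i ∈ Finset.Icc 1 A.m, (i : ℝ)⁻¹ := by
    refine hlK.trans ?_
    rw [hK]
    exact log_add_one_le_sum_inv A.m
  have hD0 : 0 < -Real.log δ := neg_pos.2 (Real.log_neg hδ hδ1)
  have hl0 : 0 ≤ l := hlx ▸ by positivity
  have hl2 : (1 : ℝ) / 2 ≤ Real.log 2 := by linarith [Real.log_two_gt_d9]
  unfold superperiodCount
  rw [hl]
  generalize (∑ i ∈ Finset.Icc 1 A.m, (i : ℝ)⁻¹) = H at *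
  generalize -Real.log δ = D at *
  generalize Real.log A.K = k at *
  have hL0 : 0 < L := by linarith
  have hk0 : 0 < k := lt_of_lt_of_le (by positivity) hlK
  have hH0 : 0 < H := lt_of_lt_of_le (by positivity) hH
  have hfloor := Nat.floor_le (a := 2 * D / Real.log 2 + 16 / (period A.m * k) *
    (l / H + 4 * A.m ^ 3 * D)) (by positivity)
  push_cast
  have h1 : (⌊2 * D / Real.log 2 + 16 / (period A.m * k) * (l / H + 4 * A.m ^ 3 * D)⌋₊ : ℝ) *
      period A.m ≤ 2 * D / Real.log 2 * period A.m + 16 / k * (l / H + 4 * A.m ^ 3 * D) := by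
    refine (mul_le_mul_of_nonneg_right hfloor hM.le).trans (le_of_eq ?_)
    field_simp
  have h2 : 2 * D / Real.log 2 * period A.m ≤ 2 * (κ * L) / (1 / 2) * (8 * A.m) := by gcongr
  have h3 : 16 / k * (l / H + 4 * A.m ^ 3 * D) ≤
      16 / (L / 8) * (l / (L / 8) + 4 * A.m ^ 3 * (κ * L)) := by gcongr
  have h4 : 16 / (L / 8) * (l / (L / 8) + 4 * A.m ^ 3 * (κ * L)) =
      1024 * (l / L ^ 2) + 512 * A.m ^ 3 * κ := by field_simp; ring
  have hm3 : (A.m : ℝ) ≤ A.m ^ 3 := le_self_pow₀ hm1 (by norm_num)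
  have hm31 : (1 : ℝ) ≤ A.m ^ 3 := one_le_pow₀ hm1
  have hκL : 1 ≤ κ * L := one_le_mul_of_one_le_of_one_le hκ hL1
  have hκκL : κ ≤ κ * L := le_mul_of_one_le_right (by linarith) hL1
  have e1 : (A.m : ℝ) ^ 3 ≤ A.m ^ 3 * (κ * L) := le_mul_of_one_le_right (by positivity) hκL
  have e2 : A.m * (κ * L) ≤ (A.m : ℝ) ^ 3 * (κ * L) := by gcongr
  have e3 : (A.m : ℝ) ^ 3 * κ ≤ A.m ^ 3 * (κ * L) := by gcongr
  have e4 : (A.m : ℝ) ^ 3 * (κ * L) ≤ (2 * x) ^ 3 * (κ * L) := by gcongr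
  -- `556 = 1 + 3 + 8 + 32 + 512` collects the lower-order terms, and `4448 = 8 * 556`. The leading
  -- `1024 = 16 * 8 * 8` comes from `h4`.
  have h5 : 556 * ((2 * x) ^ 3 * (κ * L)) ≤ l / L ^ 2 := by
    rw [le_div_iff₀ (by positivity), hlx]
    calc 556 * ((2 * x) ^ 3 * (κ * L)) * L ^ 2 = x ^ 3 * (4448 * κ * L ^ 3) := by ring
      _ ≤ x ^ 3 * x ^ 5 := by gcongr
      _ = x ^ 8 := by ring
  linarith

theorem eventually_pow_log_le (κ : ℝ) :
    ∀ᶠ x : ℝ in Filter.atTop, 4448 * κ * (8 * Real.log x) ^ 3 ≤ x ^ 5 := by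
  have h1 : (fun x : ℝ => Real.log x ^ 3) =o[Filter.atTop] fun x => x ^ (5 : ℝ) :=
    (Real.isLittleO_pow_log_id_atTop (n := 3)).trans_isBigO (by
      refine Asymptotics.IsBigO.of_bound 1 ?_
      filter_upwards [Filter.eventually_ge_atTop 1] with x hx
      have : x ≤ x ^ (5 : ℝ) := by
        conv_lhs => rw [← Real.rpow_one x]
        exact Real.rpow_le_rpow_of_exponent_le hx (by norm_num)
      simp only [id, Real.norm_eq_abs, one_mul]
      rwa [abs_of_pos (by linarith), abs_of_pos (by positivity)])
  have h2 := (h1.const_mul_left (4448 * κ * 8 ^ 3)).def one_pos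
  filter_upwards [h2, Filter.eventually_ge_atTop 1] with x hx hx1
  rw [one_mul, Real.norm_eq_abs, Real.norm_eq_abs, abs_of_pos (a := x ^ (5 : ℝ)) (by positivity)] at hx
  have h5 : x ^ (5 : ℝ) = x ^ 5 := by exact_mod_cast Real.rpow_natCast x 5
  rw [← h5, mul_pow]
  linarith [le_abs_self (4448 * κ * 8 ^ 3 * Real.log x ^ 3)]

theorem mainTheorem5 (k c : ℝ) :
    ∃ C : ℝ, ∀ ε : ℕ → ℝ, (∀ n, 0 < ε n ∧ ε n ≤ 1) →
      (∀ᶠ n : ℕ in Filter.atTop, Real.log n ^ (-k) ≤ ε n) →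
      ∃ (A : LocalAlgorithm ℝ≥0 Bool) (T : ℕ → ℕ), ∀ᶠ n : ℕ in Filter.atTop,
        (T n : ℝ) ≤ C * (Real.log n / Real.log (Real.log n) ^ 2) ∧
        ∀ (G : SimpleGraph (Fin n)) (P : PortNumbering G) (w : Fin n → ℝ≥0),
          seedMeasure (Fin n)
            {s | ¬ IsApproxMinWeightVertexCover G w (2 + ε n)
              (Finset.univ.filter fun v => A.outputAfter P w s (T n) v = true)}
            ≤ ENNReal.ofReal ((n : ℝ) ^ (-c)) := by
  -- The constant is universal: `k` only affects how large `n` must be.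
  refine ⟨1025, fun ε hε hεk => ?_⟩
  -- `δ = ε / 4` works since `(2 + ε) * (1 - ε / 4) ≥ 2` for `0 ≤ ε ≤ 1`.
  set S : ℕ → ℕ := fun n => superperiodCount (coverParams n) (ε n / 4) with hS
  refine ⟨gossip (coverRule coverParams (fun n => S n * period (coverParams n).m)
    fun n => ε n / 4), fun n => (coverParams n).m + 2 + S n * period (coverParams n).m + 1, ?_⟩
  have hlog : Filter.Tendsto (fun n : ℕ => Real.log n) Filter.atTop Filter.atTop :=
    Real.tendsto_log_atTop.comp tendsto_natCast_atTop_atTop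
  have hroot : Filter.Tendsto (fun n : ℕ => Real.log n ^ (1 / 8 : ℝ)) Filter.atTop Filter.atTop :=
    (tendsto_rpow_atTop (by norm_num)).comp hlog
  filter_upwards [hεk, hroot.eventually (eventually_pow_log_le (|k| + 1)),
    hroot.eventually_ge_atTop 1, hlog.eventually_ge_atTop 1,
    (Real.tendsto_log_atTop.comp hlog).eventually_ge_atTop 2] with n hεn hbig hx1 hl1 hL2
  simp only [Function.comp] at hL2
  obtain ⟨hε0, hε1⟩ := hε n
  have hl0 : 0 < Real.log n := by linarith
  have hm1 : 1 ≤ (coverParams n).m := Nat.one_le_ceil_iff.2 (by linarith)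
  have hδ : 0 < ε n / 4 := by linarith
  have hδ1 : ε n / 4 < 1 := by linarith
  constructor
  · have hL : Real.log (Real.log n) = 8 * Real.log (Real.log n ^ (1 / 8 : ℝ)) := by
      rw [Real.log_rpow hl0]; ring
    refine rounds_le (κ := |k| + 1) hx1 (Nat.le_ceil _) ?_ rfl rfl ?_ hL (by linarith)
      (by linarith [abs_nonneg k]) hδ1 hδ ?_ (by rwa [hL])
    · have := Nat.ceil_lt_add_one (a := Real.log n ^ (1 / 8 : ℝ)) (by linarith)
      change (⌈Real.log n ^ (1 / 8 : ℝ)⌉₊ : ℝ) ≤ _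
      linarith
    · rw [← Real.rpow_natCast, ← Real.rpow_mul hl0.le]
      norm_num
    · have h1 := Real.log_le_log (Real.rpow_pos_of_pos hl0 _) hεn
      rw [Real.log_rpow hl0] at h1
      have h2 : Real.log 4 = 2 * Real.log 2 := by
        rw [show (4 : ℝ) = 2 ^ 2 by norm_num, Real.log_pow]; norm_num
      rw [Real.log_div hε0.ne' (by norm_num), h2]
      have h3 : k * Real.log (Real.log n) ≤ |k| * Real.log (Real.log n) :=
        mul_le_mul_of_nonneg_right (le_abs_self k) (by linarith)
      linarith [Real.log_two_lt_d9]
  · intro G P w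
    -- Failure requires a collision of seeds, a null event, so the bound holds for every `c`.
    refine le_trans (le_of_eq ?_) zero_le
    refine MeasureTheory.measure_mono_null (t := {s | ¬ Function.Injective s})
      (fun s hs hinj => hs ?_)
      (seedMeasure_not_injective (Fin n))
    refine isApproxMinWeightVertexCover_gossip P w hinj coverParams S (fun n => ε n / 4)
      (Fintype.card_fin n) rfl hm1 ?_ hδ hδ1 ?_ ?_
    · change (1 : ℝ) ≤ (⌈Real.log n ^ (1 / 8 : ℝ)⌉₊ : ℝ) + 1
      linarith [Nat.cast_nonneg (α := ℝ) ⌈Real.log n ^ (1 / 8 : ℝ)⌉₊]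
    · intro r hr
      exact lt_superperiodCount hm1 rfl hδ hδ1 hr
    · nlinarith
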